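/- Let $\pi\colon E\to\mathbb{R}$ be a smooth fibred manifold (for instance a smooth fibre bundle), $E$ Hausdorff and second countable of dimension $n+1$, let $k\ge 1$, and let $J^r\pi$ denote the manifold of $r$-jets of sections of $\pi$, with natural coordinates $(t,q_i^A)$, $0\le i\le r$, $1\le A\le n$, induced by charts $(t,q^A)$ of $E$ adapted to $\pi$. Let $J^{k-1}\pi^*=T^*(J^{k-1}\pi)/(\bar\pi^{k-1})^*T^*\mathbb{R}$, where $\bar\pi^{k-1}\colon J^{k-1}\pi\to\mathbb{R}$ is the projection, with quotient map $\mu\colon T^*(J^{k-1}\pi)\to J^{k-1}\pi^*$, projection $\bar\tau\colon J^{k-1}\pi^*\to\mathbb{R}$ and natural coordinates $(t,q_i^A,p_A^i)$, $0\le i\le k-1$. Let $L\in C^\infty(J^k\pi)$ be hyperregular: the restricted Legendre–Ostrogradsky map $\mathcal{FL}\colon J^{2k-1}\pi\to J^{k-1}\pi^*$, given in natural coordinates by $$\mathcal{FL}^*t=t,\qquad \mathcal{FL}^*q_{r-1}^A=q_{r-1}^A,\qquad \mathcal{FL}^*p_A^{r-1}=\sum_{i=0}^{k-r}(-1)^i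 d_T^i\Big(\frac{\partial L}{\partial q_{r+i}^A}\Big)\qquad(1\le r\le k),$$ where $d_T$ is the total time derivative, is a diffeomorphism. Let $h\colon J^{k-1}\pi^*\to T^*(J^{k-1}\pi)$ be the associated Hamiltonian section of $\mu$: for $[\alpha]\in J^{k-1}\pi^*$ with $\mathcal{FL}^{-1}([\alpha])=j^{2k-1}_t\phi$, $h([\alpha])$ is the unique covector in the class $[\alpha]$ such that $\langle h([\alpha]),T(j^{k-1}\phi)(\partial/\partial t|_t)\rangle=L(j^k_t\phi)$. In natural coordinates $h(t,q_i^A,p_A^i)=(t,q_i^A,-H,p_A^i)$ with $$H=\sum_{i=0}^{k-1}\sum_{A=1}^n p_A^i\,(q_{i+1}^A\circ\mathcal{FL}^{-1})-L\circ\pi^{2k-1}_k\circ\mathcal{FL}^{-1},$$ where $\pi^{2k-1}_k\colon J^{2k-1}\pi\to J^k\pi$ is the projection. Let $\Omega_h=h^*\Omega_{k-1}$, where $\Omega_{k-1}=-d\Theta_{k-1}$ is the canonical symplectic form of $T^*(J^{k-1}\pi)$. Then for every smooth section $\psi_h\colon\mathbb{R}\to J^{k-1}\pi^*$ of $\bar\tau$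 the following are equivalent: 1. $\psi_h^*\,i(Y)\Omega_h=0$ for every smooth vector field $Y$ on $J^{k-1}\pi^*$. 2. In all natural coordinates, the components $\psi_h(t)=(t,q_i^A(t),p_A^i(t))$ satisfy the $k$-th order Hamilton equations $$\dot q_i^A=\frac{\partial H}{\partial p_A^i}\Big|_{\psi_h},\qquad \dot p_A^i=-\frac{\partial H}{\partial q_i^A}\Big|_{\psi_h}\qquad(0\le i\le k-1,\ 1\le A\le n).$$ 3. $i(\psi_h')(\Omega_h\circ\psi_h)=0$, where $\psi_h'\colon\mathbb{R}\to T(J^{k-1}\pi^*)$ is the canonical lift of $\psi_h$. 4. $\psi_h$ is an integral curve of some smooth vector field $X_h$ on $J^{k-1}\pi^*$ that is $\bar\tau$-transverse (that is, $i(X_h)\bar\tau^*dt$ vanishes nowhere) and satisfies $i(X_h)\Omega_h=0$. -/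

import Mathlib

open Set Filter Manifold
open scoped Topology ContDiff
noncomputable section
namespace HigherOrderMechanics

/-- Iterated partial derivatives of a smooth function are smooth, jointly in all variables. -/
theorem iter_contDiffOn {Z F : Type*} [NormedAddCommGroup Z] [NormedSpace ℝ Z]
    [NormedAddCommGroup F] [NormedSpace ℝ F] {G : Z × ℝ → F} {U : Set (Z × ℝ)} (hU : IsOpen U)
    (hG : ContDiffOn ℝ ∞ G U) (i : ℕ) :
    ContDiffOn ℝ ∞ (fun w : Z × ℝ => iteratedDeriv i (fun s => G (w.1, s)) w.2) U := by
  induction i with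
  | zero => simpa using hG
  | succ i ih =>
    have h1 : ContDiffOn ℝ ∞ (fun w : Z × ℝ =>
        fderiv ℝ (fun w : Z × ℝ => iteratedDeriv i (fun s => G (w.1, s)) w.2) w (0, 1)) U :=
      (ih.fderiv_of_isOpen hU (by simp)).clm_apply contDiffOn_const
    refine h1.congr fun w hw => ?_
    rw [iteratedDeriv_succ]
    have hd : DifferentiableAt ℝ
        (fun w : Z × ℝ => iteratedDeriv i (fun s => G (w.1, s)) w.2) (w.1, w.2) :=
      (ih.contDiffAt (hU.mem_nhds hw)).differentiableAt (by simp)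
    have hc : HasDerivAt (fun s : ℝ => (w.1, s)) ((0 : Z), (1 : ℝ)) w.2 :=
      (hasDerivAt_const _ _).prodMk (hasDerivAt_id _)
    exact (hd.hasFDerivAt.comp_hasDerivAt w.2 hc).deriv

/-- Curves in contact to order `r` stay in contact to order `r` after composition with a smooth map. -/
theorem iteratedDeriv_comp_congr {V W : Type*} [NormedAddCommGroup V] [NormedSpace ℝ V]
    [NormedAddCommGroup W] [NormedSpace ℝ W] {g : V → W} {c c' : ℝ → V} {t : ℝ} {r : ℕ}
    (hc : ContDiffAt ℝ ∞ c t) (hc' : ContDiffAt ℝ ∞ c' t)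
    (hg : ContDiffAt ℝ ∞ g (c t)) (h : ∀ i ≤ r, iteratedDeriv i c t = iteratedDeriv i c' t) :
    ∀ i ≤ r, iteratedDeriv i (g ∘ c) t = iteratedDeriv i (g ∘ c') t := by
  intro i hi
  have h0 : c t = c' t := by simpa using h 0 (Nat.zero_le _)
  have hj : ∀ j ≤ r, iteratedFDeriv ℝ j c t = iteratedFDeriv ℝ j c' t := by
    intro j hj
    rw [iteratedFDeriv_eq_equiv_comp, iteratedFDeriv_eq_equiv_comp]
    simp [h j hj]
  rw [iteratedDeriv_eq_iteratedFDeriv, iteratedDeriv_eq_iteratedFDeriv,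
    iteratedFDeriv_comp hg hc (by exact_mod_cast le_top),
    iteratedFDeriv_comp (h0 ▸ hg) hc' (by exact_mod_cast le_top), h0]
  congr 1
  unfold FormalMultilinearSeries.taylorComp
  refine Finset.sum_congr rfl fun p _ => ?_
  have : (fun m => ftaylorSeries ℝ c t (p.partSize m)) =
      fun m => ftaylorSeries ℝ c' t (p.partSize m) := by
    funext m
    exact hj _ ((p.partSize_le m).trans hi)
  ext
  simp only [FormalMultilinearSeries.compAlongOrderedFinpartition_apply, this]

/-- The model of the fibres of the configuration bundle (coordinates `q^A`). -/
abbrev Fib (n : ℕ) : Type := Fin n → ℝ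

/-- Coordinates `q_i^A` with `0 ≤ i ≤ r`, or `p_A^i` with `0 ≤ i ≤ r`. -/
abbrev JetFib (n r : ℕ) : Type := Fin (r + 1) → Fin n → ℝ

/-- The model `(t, q_i^A)` of the jet manifold of order `r`. -/
abbrev JetModel (n r : ℕ) : Type := ℝ × JetFib n r

variable {n : ℕ} {E : Type*} [TopologicalSpace E] [ChartedSpace (ℝ × Fib n) E]

/-- A smooth chart `(t, q^A)` of `E` is adapted to `π` if its first coordinate is `π`. -/
structure IsAdapted (π : E → ℝ) (e : OpenPartialHomeomorph E (ℝ × Fib n)) : Prop where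
  mem_maximalAtlas : e ∈ IsManifold.maximalAtlas 𝓘(ℝ, ℝ × Fib n) ∞ E
  fst_eq : ∀ x ∈ e.source, (e x).1 = π x

/-- `π : E → ℝ` is a smooth fibred manifold (for instance a smooth fibre bundle) with
`n`-dimensional fibres: around each point there is an adapted chart. -/
class IsFibered (n : ℕ) {E : Type*} [TopologicalSpace E] [ChartedSpace (ℝ × Fib n) E]
    (π : E → ℝ) : Prop where
  exists_adapted : ∀ x : E, ∃ e : OpenPartialHomeomorph E (ℝ × Fib n), IsAdapted π e ∧ x ∈ e.source

variable (n) in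
/-- A smooth section of `π` defined around the instant `time`. -/
structure LocalSection (π : E → ℝ) where
  time : ℝ
  toFun : ℝ → E
  isSection : ∀ᶠ s in 𝓝 time,
    ContMDiffAt 𝓘(ℝ, ℝ) 𝓘(ℝ, ℝ × Fib n) ∞ toFun s ∧ π (toFun s) = s

/-- The components `φ^A` of a section in the chart `e`. -/
def fibCurve (e : OpenPartialHomeomorph E (ℝ × Fib n)) (φ : ℝ → E) : ℝ → Fib n :=
  fun s => (e (φ s)).2

variable {π : E → ℝ}

theorem LocalSection.smooth_pair (σ : LocalSection n π)
    {e : OpenPartialHomeomorph E (ℝ × Fib n)} (he : IsAdapted π e)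
    (hx : σ.toFun σ.time ∈ e.source) :
    ContDiffAt ℝ ∞ (fun s => e (σ.toFun s)) σ.time := by
  have h1 := σ.isSection.self_of_nhds.1
  have h2 := (contMDiffOn_of_mem_maximalAtlas he.mem_maximalAtlas).contMDiffAt
    (e.open_source.mem_nhds hx)
  exact contMDiffAt_iff_contDiffAt.1 (h2.comp σ.time h1)

theorem LocalSection.eventually_source (σ : LocalSection n π)
    {e : OpenPartialHomeomorph E (ℝ × Fib n)} (hx : σ.toFun σ.time ∈ e.source) :
    ∀ᶠ s in 𝓝 σ.time, σ.toFun s ∈ e.source :=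
  σ.isSection.self_of_nhds.1.continuousAt (e.open_source.mem_nhds hx)

theorem LocalSection.eventually_eq (σ : LocalSection n π)
    {e : OpenPartialHomeomorph E (ℝ × Fib n)} (he : IsAdapted π e)
    (hx : σ.toFun σ.time ∈ e.source) :
    (fun s => e (σ.toFun s)) =ᶠ[𝓝 σ.time] fun s => (s, fibCurve e σ.toFun s) := by
  filter_upwards [σ.eventually_source hx, σ.isSection] with s h1 h2
  exact Prod.ext ((he.fst_eq _ h1).trans h2.2) rfl

/-- Contact of order `r` of two sections does not depend on the adapted chart. -/
theorem contact_change {σ τ : LocalSection n π} (ht : σ.time = τ.time)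
    (hx : σ.toFun σ.time = τ.toFun τ.time)
    {e e' : OpenPartialHomeomorph E (ℝ × Fib n)} (he : IsAdapted π e) (he' : IsAdapted π e')
    (hs : σ.toFun σ.time ∈ e.source) (hs' : σ.toFun σ.time ∈ e'.source) {r : ℕ}
    (h : ∀ i ≤ r, iteratedDeriv i (fibCurve e σ.toFun) σ.time =
      iteratedDeriv i (fibCurve e τ.toFun) τ.time) :
    ∀ i ≤ r, iteratedDeriv i (fibCurve e' σ.toFun) σ.time =
      iteratedDeriv i (fibCurve e' τ.toFun) τ.time := by
  have hts : τ.toFun τ.time ∈ e.source := hx ▸ hs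
  have hts' : τ.toFun τ.time ∈ e'.source := hx ▸ hs'
  have hcs := σ.smooth_pair he hs
  have hct := τ.smooth_pair he hts
  have hg : ContDiffAt ℝ ∞ (fun z => (e' (e.symm z)).2) (e (σ.toFun σ.time)) := by
    have h1 := (contMDiffOn_of_mem_maximalAtlas he'.mem_maximalAtlas).contMDiffAt
      (e'.open_source.mem_nhds hs')
    have h2 := (contMDiffOn_symm_of_mem_maximalAtlas he.mem_maximalAtlas).contMDiffAt
      (e.open_target.mem_nhds (e.map_source hs))
    rw [← e.left_inv hs] at h1
    exact (contMDiffAt_iff_contDiffAt.1 (h1.comp _ h2)).snd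
  have hpair : ∀ i ≤ r, iteratedDeriv i (fun s => e (σ.toFun s)) σ.time =
      iteratedDeriv i (fun s => e (τ.toFun s)) σ.time := by
    intro i hi
    have a1 := (σ.eventually_eq he hs).iteratedDeriv_eq i
    have a2 := (τ.eventually_eq he hts).iteratedDeriv_eq i
    have e0 := h i hi
    rw [a1, ht, a2]
    rw [ht] at e0
    have b1 : ContDiffAt ℝ i (fibCurve e σ.toFun) τ.time :=
      ((ht ▸ hcs).snd).of_le (by exact_mod_cast le_top)
    have b2 : ContDiffAt ℝ i (fibCurve e τ.toFun) τ.time :=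
      hct.snd.of_le (by exact_mod_cast le_top)
    have hid : ContDiffAt ℝ i (fun s : ℝ => s) τ.time := contDiffAt_id
    rw [iteratedDeriv_eq_iteratedFDeriv] at e0 ⊢
    rw [iteratedDeriv_eq_iteratedFDeriv] at e0 ⊢
    rw [iteratedFDeriv_prodMk hid b1 le_rfl, iteratedFDeriv_prodMk hid b2 le_rfl]
    exact Prod.ext rfl e0
  have key := iteratedDeriv_comp_congr hcs (ht ▸ hct) hg hpair
  intro i hi
  have c1 : fibCurve e' σ.toFun =ᶠ[𝓝 σ.time]
      (fun z => (e' (e.symm z)).2) ∘ fun s => e (σ.toFun s) := by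
    filter_upwards [σ.eventually_source hs] with s h1
    simp [fibCurve, e.left_inv h1]
  have c2 : fibCurve e' τ.toFun =ᶠ[𝓝 τ.time]
      (fun z => (e' (e.symm z)).2) ∘ fun s => e (τ.toFun s) := by
    filter_upwards [τ.eventually_source hts] with s h1
    simp [fibCurve, e.left_inv h1]
  rw [c1.iteratedDeriv_eq i, c2.iteratedDeriv_eq i, key i hi, ht]

variable (n π) in
/-- Two local sections have the same `r`-jet if they are taken at the same instant, have the same
value there, and their components have the same derivatives up to order `r` there. -/
def jetSetoid (r : ℕ) : Setoid (LocalSection n π) where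
  r σ τ := σ.time = τ.time ∧ σ.toFun σ.time = τ.toFun τ.time ∧
    ∀ e : OpenPartialHomeomorph E (ℝ × Fib n), IsAdapted π e → σ.toFun σ.time ∈ e.source →
      ∀ i ≤ r, iteratedDeriv i (fibCurve e σ.toFun) σ.time =
        iteratedDeriv i (fibCurve e τ.toFun) τ.time
  iseqv :=
    { refl := fun _ => ⟨rfl, rfl, fun _ _ _ _ _ => rfl⟩
      symm := fun h => ⟨h.1.symm, h.2.1.symm, fun e he hs i hi =>
        (h.2.2 e he (h.2.1.symm ▸ hs) i hi).symm⟩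
      trans := fun h h' => ⟨h.1.trans h'.1, h.2.1.trans h'.2.1, fun e he hs i hi =>
        (h.2.2 e he hs i hi).trans (h'.2.2 e he (h.2.1 ▸ hs) i hi)⟩ }

variable (n π) in
/-- The jet space `J^r π` of `r`-jets of sections of `π`. -/
def Jet (r : ℕ) : Type _ := Quotient (jetSetoid n π r)

namespace Jet
variable {r : ℕ}

/-- A section that represents the jet. -/
def rep (y : Jet n π r) : LocalSection n π := Quotient.out y

/-- The `r`-jet of a section at its instant. -/
def ofSection (r : ℕ) (σ : LocalSection n π) : Jet n π r := Quotient.mk _ σ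

/-- The projection of `J^r π` to `ℝ`. -/
def time (y : Jet n π r) : ℝ := y.rep.time

/-- The projection of `J^r π` to `E`. -/
def base (y : Jet n π r) : E := y.rep.toFun y.rep.time

/-- The natural coordinates `(t, q_i^A)` of `J^r π` induced by an adapted chart. -/
def coord (e : OpenPartialHomeomorph E (ℝ × Fib n)) (y : Jet n π r) : JetModel n r :=
  (y.time, fun i => iteratedDeriv i (fibCurve e y.rep.toFun) y.time)

theorem rep_rel (σ : LocalSection n π) : (jetSetoid n π r).r (ofSection r σ).rep σ :=
  Quotient.mk_out (s := jetSetoid n π r) σ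

theorem ofSection_rep (y : Jet n π r) : ofSection r y.rep = y := Quotient.out_eq y

@[simp] theorem time_ofSection (σ : LocalSection n π) : (ofSection r σ).time = σ.time :=
  (rep_rel σ).1

@[simp] theorem base_ofSection (σ : LocalSection n π) :
    (ofSection r σ).base = σ.toFun σ.time := (rep_rel σ).2.1

theorem coord_ofSection {e : OpenPartialHomeomorph E (ℝ × Fib n)} (he : IsAdapted π e)
    (σ : LocalSection n π) (hs : σ.toFun σ.time ∈ e.source) :
    (ofSection r σ).coord e =
      (σ.time, fun i : Fin (r + 1) => iteratedDeriv i (fibCurve e σ.toFun) σ.time) := by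
  refine Prod.ext (time_ofSection σ) ?_
  funext i
  exact (rep_rel σ).2.2 e he
    (by rw [show (ofSection r σ).rep.toFun _ = _ from base_ofSection (r := r) σ]; exact hs)
    i (Nat.lt_succ_iff.1 i.2)

end Jet

/-- The polynomial curve with prescribed derivatives `q_i` at the instant `t`. -/
def taylorCurve {r : ℕ} (z : JetModel n r) (s : ℝ) : Fib n :=
  ∑ i : Fin (r + 1), ((s - z.1) ^ (i : ℕ) / (Nat.factorial i : ℝ)) • z.2 i

theorem taylorCurve_contDiff {r : ℕ} :
    ContDiff ℝ ∞ (fun w : JetModel n r × ℝ => taylorCurve w.1 w.2) := by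
  unfold taylorCurve
  fun_prop

theorem taylorCurve_self {r : ℕ} (z : JetModel n r) : taylorCurve z z.1 = z.2 0 := by
  unfold taylorCurve
  rw [Fin.sum_univ_succ]
  simp

theorem iteratedDeriv_taylorCurve {r : ℕ} (z : JetModel n r) (i : Fin (r + 1)) :
    iteratedDeriv i (taylorCurve z) z.1 = z.2 i := by
  have h : ∀ (k j : ℕ) (v : Fib n), iteratedDeriv k
      (fun s : ℝ => ((s - z.1) ^ j / (Nat.factorial j : ℝ)) • v) z.1 =
      if k = j then v else 0 := by
    intro k
    induction k with
    | zero =>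
      intro j v
      rcases j with _ | j <;> simp
    | succ k ih =>
      intro j v
      rw [iteratedDeriv_succ']
      rcases j with _ | j
      · simp
      · have : deriv (fun s : ℝ => ((s - z.1) ^ (j + 1) / (Nat.factorial (j + 1) : ℝ)) • v) =
            fun s : ℝ => ((s - z.1) ^ j / (Nat.factorial j : ℝ)) • v := by
          funext s
          have h1 : HasDerivAt (fun s : ℝ => (s - z.1) ^ (j + 1) / (Nat.factorial (j + 1) : ℝ))
              ((s - z.1) ^ j / (Nat.factorial j : ℝ)) s := by
            have := (((hasDerivAt_id s).sub_const z.1).pow (j + 1)).div_const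
              (Nat.factorial (j + 1) : ℝ)
            refine this.congr_deriv ?_
            have hj : (Nat.factorial j : ℝ) ≠ 0 := by exact_mod_cast Nat.factorial_ne_zero j
            rw [Nat.factorial_succ]
            push_cast
            simp
            field_simp
          exact (h1.smul_const v).deriv
        rw [this, ih]
        simp
  have hsum : iteratedDeriv i (taylorCurve z) z.1 = ∑ j : Fin (r + 1), iteratedDeriv i
      (fun s : ℝ => ((s - z.1) ^ (j : ℕ) / (Nat.factorial j : ℝ)) • z.2 j) z.1 := by
    have : taylorCurve z = fun s => ∑ j : Fin (r + 1),
      (fun s : ℝ => ((s - z.1) ^ (j : ℕ) / (Nat.factorial j : ℝ)) • z.2 j) s := rfl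
    rw [this, iteratedDeriv_fun_sum]
    intro j _
    fun_prop
  rw [hsum]
  simp only [h, Fin.val_inj]
  simp

theorem mem_target_of_adapted {e : OpenPartialHomeomorph E (ℝ × Fib n)} (he : IsAdapted π e)
    {x : E} (hx : x ∈ e.source) : e x = (π x, (e x).2) := Prod.ext (he.fst_eq x hx) rfl

/-- The section that is polynomial in the chart `e`, with prescribed natural jet coordinates. -/
def taylorSection {e : OpenPartialHomeomorph E (ℝ × Fib n)} (he : IsAdapted π e) {r : ℕ}
    (z : JetModel n r) (hz : (z.1, z.2 0) ∈ e.target) : LocalSection n π where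
  time := z.1
  toFun := fun s => e.symm (s, taylorCurve z s)
  isSection := by
    have hc : ContDiff ℝ ∞ (fun s : ℝ => (s, taylorCurve z s)) :=
      contDiff_id.prodMk (taylorCurve_contDiff.comp (contDiff_const.prodMk contDiff_id))
    have hmem : ∀ᶠ s in 𝓝 z.1, (s, taylorCurve z s) ∈ e.target := by
      refine hc.continuous.continuousAt (e.open_target.mem_nhds ?_)
      rwa [taylorCurve_self]
    filter_upwards [hmem] with s hs
    refine ⟨?_, ?_⟩
    · have h2 := (contMDiffOn_symm_of_mem_maximalAtlas he.mem_maximalAtlas).contMDiffAt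
        (e.open_target.mem_nhds hs)
      exact h2.comp s (contMDiffAt_iff_contDiffAt.2 hc.contDiffAt)
    · rw [← he.fst_eq _ (e.map_target hs), e.right_inv hs]

theorem coord_taylorSection {e : OpenPartialHomeomorph E (ℝ × Fib n)} (he : IsAdapted π e) {r : ℕ}
    (z : JetModel n r) (hz : (z.1, z.2 0) ∈ e.target) :
    (Jet.ofSection r (taylorSection he z hz)).coord e = z := by
  have hs : (taylorSection he z hz).toFun (taylorSection he z hz).time ∈ e.source := by
    refine e.map_target ?_
    change (z.1, taylorCurve z z.1) ∈ _
    rwa [taylorCurve_self]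
  rw [Jet.coord_ofSection he _ hs]
  refine Prod.ext rfl ?_
  funext i
  rw [← iteratedDeriv_taylorCurve z i]
  refine Filter.EventuallyEq.iteratedDeriv_eq i ?_
  have hc : Continuous (fun s : ℝ => (s, taylorCurve z s)) :=
    (contDiff_id.prodMk (taylorCurve_contDiff.comp (contDiff_const.prodMk contDiff_id))
      : ContDiff ℝ ∞ _).continuous
  have hmem : ∀ᶠ s in 𝓝 z.1, (s, taylorCurve z s) ∈ e.target := by
    refine hc.continuousAt (e.open_target.mem_nhds ?_)
    rwa [taylorCurve_self]
  filter_upwards [hmem] with s hs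
  simp [fibCurve, taylorSection, e.right_inv hs]

theorem Jet.ext_coord {r : ℕ} {e : OpenPartialHomeomorph E (ℝ × Fib n)} (he : IsAdapted π e)
    {y y' : Jet n π r} (hy : y.base ∈ e.source) (hy' : y'.base ∈ e.source)
    (h : y.coord e = y'.coord e) : y = y' := by
  have ht : y.rep.time = y'.rep.time := congrArg Prod.fst h
  have hd : ∀ i ≤ r, iteratedDeriv i (fibCurve e y.rep.toFun) y.rep.time =
      iteratedDeriv i (fibCurve e y'.rep.toFun) y'.rep.time := fun i hi =>
    congrFun (congrArg Prod.snd h) (⟨i, Nat.lt_succ_iff.2 hi⟩ : Fin (r + 1))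
  have hb : y.rep.toFun y.rep.time = y'.rep.toFun y'.rep.time := by
    refine e.injOn hy hy' (Prod.ext ?_ ?_)
    · have h1 := (y.rep.isSection.self_of_nhds).2
      have h2 := (y'.rep.isSection.self_of_nhds).2
      have h3 := he.fst_eq _ hy
      have h4 := he.fst_eq _ hy'
      simp only [Jet.base] at h3 h4
      change (e (y.rep.toFun y.rep.time)).1 = (e (y'.rep.toFun y'.rep.time)).1
      rw [h3, h4, h1, h2, ht]
    · have h0 := hd 0 (Nat.zero_le _)
      simp only [iteratedDeriv_zero] at h0
      exact h0
  rw [← y.ofSection_rep, ← y'.ofSection_rep]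
  exact Quotient.sound (s := jetSetoid n π r)
    ⟨ht, hb, fun e' he' hs' => contact_change ht hb he he' hy hs' hd⟩

theorem base_taylorSection {e : OpenPartialHomeomorph E (ℝ × Fib n)} (he : IsAdapted π e) {r : ℕ}
    (z : JetModel n r) (hz : (z.1, z.2 0) ∈ e.target) :
    (Jet.ofSection r (taylorSection he z hz)).base = e.symm (z.1, z.2 0) := by
  rw [Jet.base_ofSection]
  change e.symm (z.1, taylorCurve z z.1) = _
  rw [taylorCurve_self]

theorem base_taylorSection_mem {e : OpenPartialHomeomorph E (ℝ × Fib n)} (he : IsAdapted π e)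
    {r : ℕ} (z : JetModel n r) (hz : (z.1, z.2 0) ∈ e.target) :
    (Jet.ofSection r (taylorSection he z hz)).base ∈ e.source := by
  rw [base_taylorSection]
  exact e.map_target hz

theorem Jet.coord_zero {r : ℕ} {e : OpenPartialHomeomorph E (ℝ × Fib n)} (he : IsAdapted π e)
    {y : Jet n π r} (hy : y.base ∈ e.source) :
    ((Jet.coord e y).1, (Jet.coord e y).2 0) = e y.base := by
  refine Prod.ext ?_ ?_
  · rw [he.fst_eq _ hy]
    exact (y.rep.isSection.self_of_nhds).2.symm
  · simp [Jet.coord, fibCurve, Jet.base, Jet.time]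

theorem Jet.coord_mem_target {r : ℕ} {e : OpenPartialHomeomorph E (ℝ × Fib n)}
    (he : IsAdapted π e) {y : Jet n π r} (hy : y.base ∈ e.source) :
    ((Jet.coord e y).1, (Jet.coord e y).2 0) ∈ e.target :=
  Jet.coord_zero he hy ▸ e.map_source hy

open Classical in
/-- The natural chart of `J^r π`. The jet `y₀` is only the value of the inverse off the target. -/
def Jet.chart {r : ℕ} (y₀ : Jet n π r) {e : OpenPartialHomeomorph E (ℝ × Fib n)}
    (he : IsAdapted π e) : PartialEquiv (Jet n π r) (JetModel n r) where
  toFun := Jet.coord e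
  invFun z := if hz : (z.1, z.2 0) ∈ e.target then .ofSection r (taylorSection he z hz) else y₀
  source := {y | y.base ∈ e.source}
  target := {z | (z.1, z.2 0) ∈ e.target}
  map_source' := fun y hy => Jet.coord_mem_target he hy
  map_target' := by
    intro z hz
    change (z.1, z.2 0) ∈ e.target at hz
    rw [dif_pos hz]
    exact base_taylorSection_mem he z hz
  left_inv' := by
    intro y hy
    rw [dif_pos (Jet.coord_mem_target he hy)]
    exact Jet.ext_coord he (base_taylorSection_mem he _ _) hy (coord_taylorSection he _ _)
  right_inv' := by
    intro z hz
    change (z.1, z.2 0) ∈ e.target at hz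
    rw [dif_pos hz]
    exact coord_taylorSection he z hz

theorem Jet.chart_symm_apply {r : ℕ} (y₀ : Jet n π r) {e : OpenPartialHomeomorph E (ℝ × Fib n)}
    (he : IsAdapted π e) {z : JetModel n r} (hz : (z.1, z.2 0) ∈ e.target) :
    (Jet.chart y₀ he).symm z = .ofSection r (taylorSection he z hz) := dif_pos hz

theorem Jet.trans_source {r : ℕ} (y₀ y₁ : Jet n π r)
    {e e' : OpenPartialHomeomorph E (ℝ × Fib n)} (he : IsAdapted π e) (he' : IsAdapted π e') :
    ((Jet.chart y₀ he).symm.trans (Jet.chart y₁ he')).source =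
      {z | (z.1, z.2 0) ∈ (e.symm.trans e').source} := by
  ext z
  simp only [PartialEquiv.trans_source, OpenPartialHomeomorph.trans_source, mem_inter_iff,
    mem_preimage, mem_ofPred_eq]
  refine and_congr_right fun hz => ?_
  have hz' : (z.1, z.2 0) ∈ e.target := hz
  rw [Jet.chart_symm_apply y₀ he hz', ← base_taylorSection he z hz']
  rfl

theorem transition_contDiffOn (e e' : OpenPartialHomeomorph E (ℝ × Fib n))
    (he : e ∈ IsManifold.maximalAtlas 𝓘(ℝ, ℝ × Fib n) ∞ E)
    (he' : e' ∈ IsManifold.maximalAtlas 𝓘(ℝ, ℝ × Fib n) ∞ E) (r : ℕ) :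
    ContDiffOn ℝ ∞ (fun z : JetModel n r => (z.1, fun i : Fin (r + 1) =>
      iteratedDeriv i (fun s => (e' (e.symm (s, taylorCurve z s))).2) z.1))
      {z | (z.1, z.2 0) ∈ (e.symm.trans e').source} := by
  have hg : ContDiffOn ℝ ∞ (fun w => (e' (e.symm w)).2) (e.symm.trans e').source := by
    intro w hw
    rw [OpenPartialHomeomorph.trans_source] at hw
    have h1 := (contMDiffOn_of_mem_maximalAtlas he').contMDiffAt
      (e'.open_source.mem_nhds hw.2)
    have h2 := (contMDiffOn_symm_of_mem_maximalAtlas he).contMDiffAt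
      (e.open_target.mem_nhds hw.1)
    exact (contMDiffAt_iff_contDiffAt.1 (h1.comp _ h2)).snd.contDiffWithinAt
  have hP : ContDiff ℝ ∞ (fun w : JetModel n r × ℝ => (w.2, taylorCurve w.1 w.2)) :=
    contDiff_snd.prodMk taylorCurve_contDiff
  have hG : ContDiffOn ℝ ∞
      (fun w : JetModel n r × ℝ => (e' (e.symm (w.2, taylorCurve w.1 w.2))).2)
      ((fun w : JetModel n r × ℝ => (w.2, taylorCurve w.1 w.2)) ⁻¹' (e.symm.trans e').source) :=
    hg.comp hP.contDiffOn (fun _ h => h)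
  have hU := (e.symm.trans e').open_source.preimage hP.continuous
  have hdiag : ContDiff ℝ ∞ (fun z : JetModel n r => (z, z.1)) := contDiff_id.prodMk contDiff_fst
  have hmaps : MapsTo (fun z : JetModel n r => (z, z.1))
      {z : JetModel n r | (z.1, z.2 0) ∈ (e.symm.trans e').source}
      ((fun w : JetModel n r × ℝ => (w.2, taylorCurve w.1 w.2)) ⁻¹' (e.symm.trans e').source) := by
    intro z hz
    rw [mem_preimage]
    dsimp only
    rw [taylorCurve_self]
    exact hz
  refine contDiffOn_fst.prodMk (contDiffOn_pi.2 fun i => ?_)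
  have h := iter_contDiffOn hU hG (i : ℕ)
  generalize hD : (fun w : JetModel n r × ℝ =>
    iteratedDeriv i (fun s => (e' (e.symm (s, taylorCurve w.1 s))).2) w.2) = D at h
  have := h.comp hdiag.contDiffOn hmaps
  rw [← hD] at this
  exact this

theorem Jet.trans_eqOn {r : ℕ} (y₀ y₁ : Jet n π r)
    {e e' : OpenPartialHomeomorph E (ℝ × Fib n)} (he : IsAdapted π e) (he' : IsAdapted π e') :
    EqOn ((Jet.chart y₀ he).symm.trans (Jet.chart y₁ he'))
      (fun z : JetModel n r => (z.1, fun i : Fin (r + 1) =>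
        iteratedDeriv i (fun s => (e' (e.symm (s, taylorCurve z s))).2) z.1))
      {z | (z.1, z.2 0) ∈ (e.symm.trans e').source} := by
  intro z hz
  have hz0 : (z.1, z.2 0) ∈ (e.symm.trans e').source := hz
  rw [OpenPartialHomeomorph.trans_source] at hz0
  have hz1 : (z.1, z.2 0) ∈ e.target := hz0.1
  have hz2 : e.symm (z.1, z.2 0) ∈ e'.source := hz0.2
  change Jet.coord e' ((Jet.chart y₀ he).symm z) = _
  rw [Jet.chart_symm_apply y₀ he hz1, Jet.coord_ofSection he']
  · rfl
  · rw [← Jet.base_ofSection (r := r), base_taylorSection]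
    exact hz2

theorem Jet.trans_contDiffOn {r : ℕ} (y₀ y₁ : Jet n π r)
    {e e' : OpenPartialHomeomorph E (ℝ × Fib n)} (he : IsAdapted π e) (he' : IsAdapted π e') :
    ContDiffOn ℝ ∞ ((Jet.chart y₀ he).symm.trans (Jet.chart y₁ he'))
      {z | (z.1, z.2 0) ∈ (e.symm.trans e').source} :=
  (transition_contDiffOn e e' he.mem_maximalAtlas he'.mem_maximalAtlas r).congr
    (Jet.trans_eqOn y₀ y₁ he he')

variable (n π) in
open Classical in
/-- The atlas of natural charts, which gives `J^r π` its topology and smooth structure. -/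
def Jet.core (r : ℕ) [h : IsFibered n π] : ChartedSpaceCore (JetModel n r) (Jet n π r) where
  atlas := {f | ∃ (y₀ : Jet n π r) (e : OpenPartialHomeomorph E (ℝ × Fib n))
    (he : IsAdapted π e), f = Jet.chart y₀ he}
  chartAt y := Jet.chart y (h.exists_adapted y.base).choose_spec.1
  mem_chart_source y := (h.exists_adapted y.base).choose_spec.2
  chart_mem_atlas y := ⟨y, _, (h.exists_adapted y.base).choose_spec.1, rfl⟩
  open_source := by
    rintro _ _ ⟨y₀, e, he, rfl⟩ ⟨y₁, e', he', rfl⟩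
    rw [Jet.trans_source]
    exact (e.symm.trans e').open_source.preimage (by fun_prop)
  continuousOn_toFun := by
    rintro _ _ ⟨y₀, e, he, rfl⟩ ⟨y₁, e', he', rfl⟩
    rw [Jet.trans_source]
    exact (Jet.trans_contDiffOn y₀ y₁ he he').continuousOn

instance (r : ℕ) [IsFibered n π] : TopologicalSpace (Jet n π r) :=
  (Jet.core n π r).toTopologicalSpace

instance (r : ℕ) [IsFibered n π] : ChartedSpace (JetModel n r) (Jet n π r) :=
  (Jet.core n π r).toChartedSpace

instance (r : ℕ) [IsFibered n π] : IsManifold 𝓘(ℝ, JetModel n r) ∞ (Jet n π r) := by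
  refine isManifold_of_contDiffOn _ _ _ ?_
  intro f f' hf hf'
  obtain ⟨_, ⟨f₀, rfl⟩, _, ⟨⟨y₀, e, he, rfl⟩, rfl⟩, rfl⟩ := hf
  obtain ⟨_, ⟨f₁, rfl⟩, _, ⟨⟨y₁, e', he', rfl⟩, rfl⟩, rfl⟩ := hf'
  have h1 := Jet.trans_contDiffOn y₀ y₁ he he'
  rw [← Jet.trans_source y₀ y₁ he he'] at h1
  simp only [modelWithCornersSelf_coe, modelWithCornersSelf_coe_symm, Function.comp_id,
    Function.id_comp, preimage_id, range_id, inter_univ]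
  exact h1

section Bundles
variable {r : ℕ} [IsFibered n π]

instance : IsManifold 𝓘(ℝ, JetModel n r) (∞ + 1) (Jet n π r) :=
  inferInstanceAs (IsManifold 𝓘(ℝ, JetModel n r) ∞ (Jet n π r))

/-- The natural chart as a homeomorphism between open sets. -/
def Jet.openChart (y₀ : Jet n π r) {e : OpenPartialHomeomorph E (ℝ × Fib n)} (he : IsAdapted π e) :
    OpenPartialHomeomorph (Jet n π r) (JetModel n r) :=
  (Jet.core n π r).openPartialHomeomorph (Jet.chart y₀ he) ⟨y₀, e, he, rfl⟩

theorem Jet.openChart_mem_atlas (y₀ : Jet n π r) {e : OpenPartialHomeomorph E (ℝ × Fib n)}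
    (he : IsAdapted π e) : Jet.openChart y₀ he ∈ atlas (JetModel n r) (Jet n π r) :=
  mem_iUnion.2 ⟨_, mem_iUnion.2 ⟨⟨y₀, e, he, rfl⟩, rfl⟩⟩

/-- The cotangent space of `J^r π` at `x`. -/
abbrev CotangentSpace (x : Jet n π r) : Type := TangentSpace 𝓘(ℝ, JetModel n r) x →L[ℝ] ℝ

/-- The cotangent bundle of `J^r π`, with its smooth structure of a vector bundle. -/
abbrev Cotangent (n : ℕ) {E : Type*} [TopologicalSpace E] [ChartedSpace (ℝ × Fib n) E]
    (π : E → ℝ) [IsFibered n π] (r : ℕ) : Type _ :=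
  Bundle.TotalSpace (JetModel n r →L[ℝ] ℝ)
    (fun x : Jet n π r => TangentSpace 𝓘(ℝ, JetModel n r) x →L[ℝ] Bundle.Trivial (Jet n π r) ℝ x)

/-- The differential of `t` at `x`. It spans the pull-back of the cotangent line of `ℝ`. -/
def dt (x : Jet n π r) : CotangentSpace x :=
  mfderiv 𝓘(ℝ, JetModel n r) 𝓘(ℝ, ℝ) Jet.time x

/-- The differential of `q_i^A` at `x`. -/
def dq (e : OpenPartialHomeomorph E (ℝ × Fib n)) (i : Fin (r + 1)) (A : Fin n) (x : Jet n π r) :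
    CotangentSpace x :=
  mfderiv 𝓘(ℝ, JetModel n r) 𝓘(ℝ, ℝ) (fun y : Jet n π r => (y.coord e).2 i A) x

/-- The coordinate vector with index `(i, A)`. -/
def qVec {n r : ℕ} (i : Fin (r + 1)) (A : Fin n) : JetFib n r := Pi.single i (Pi.single A 1)

/-- The differential at `x` of the natural coordinate system. -/
def dcoord (e : OpenPartialHomeomorph E (ℝ × Fib n)) (x : Jet n π r) :
    TangentSpace 𝓘(ℝ, JetModel n r) x →L[ℝ] JetModel n r :=
  mfderiv 𝓘(ℝ, JetModel n r) 𝓘(ℝ, JetModel n r) (Jet.coord e) x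

/-- The tangent vector `∂/∂q_i^A` at `x`. -/
def partialq (e : OpenPartialHomeomorph E (ℝ × Fib n)) (i : Fin (r + 1)) (A : Fin n)
    (x : Jet n π r) : TangentSpace 𝓘(ℝ, JetModel n r) x :=
  (dcoord e x).inverse (0, qVec i A)

theorem mdifferentiableAt_coord {e : OpenPartialHomeomorph E (ℝ × Fib n)} (he : IsAdapted π e)
    {x : Jet n π r} (hx : x.base ∈ e.source) :
    MDifferentiableAt 𝓘(ℝ, JetModel n r) 𝓘(ℝ, JetModel n r) (Jet.coord e) x :=
  (mdifferentiable_of_mem_atlas (Jet.openChart_mem_atlas x he)).mdifferentiableAt hx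

theorem dcoord_isInvertible {e : OpenPartialHomeomorph E (ℝ × Fib n)} (he : IsAdapted π e)
    {x : Jet n π r} (hx : x.base ∈ e.source) : (dcoord e x).IsInvertible :=
  ⟨(mdifferentiable_of_mem_atlas (I := 𝓘(ℝ, JetModel n r))
    (Jet.openChart_mem_atlas x he)).mfderiv hx, rfl⟩

theorem dt_eq (e : OpenPartialHomeomorph E (ℝ × Fib n)) {x : Jet n π r}
    (h : MDifferentiableAt 𝓘(ℝ, JetModel n r) 𝓘(ℝ, JetModel n r) (Jet.coord e) x) :
    dt x = (ContinuousLinearMap.fst ℝ ℝ (JetFib n r)).comp (dcoord e x) := by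
  have h1 : HasMFDerivAt 𝓘(ℝ, JetModel n r) 𝓘(ℝ, ℝ) (Prod.fst : JetModel n r → ℝ)
      (x.coord e) (ContinuousLinearMap.fst ℝ ℝ (JetFib n r)) :=
    (ContinuousLinearMap.fst ℝ ℝ (JetFib n r)).hasFDerivAt.hasMFDerivAt
  exact (h1.comp x h.hasMFDerivAt).mfderiv

theorem dq_eq (e : OpenPartialHomeomorph E (ℝ × Fib n)) {x : Jet n π r}
    (h : MDifferentiableAt 𝓘(ℝ, JetModel n r) 𝓘(ℝ, JetModel n r) (Jet.coord e) x)
    (i : Fin (r + 1)) (A : Fin n) (v : TangentSpace 𝓘(ℝ, JetModel n r) x) :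
    dq e i A x v = (dcoord e x v).2 i A := by
  let l : JetModel n r →L[ℝ] ℝ := (ContinuousLinearMap.proj A).comp
    ((ContinuousLinearMap.proj i).comp (ContinuousLinearMap.snd ℝ ℝ (JetFib n r)))
  have h1 : HasMFDerivAt 𝓘(ℝ, JetModel n r) 𝓘(ℝ, ℝ) (l : JetModel n r → ℝ)
      (x.coord e) l := l.hasFDerivAt.hasMFDerivAt
  exact DFunLike.congr_fun (h1.comp x h.hasMFDerivAt).mfderiv v

theorem dt_partialq (e : OpenPartialHomeomorph E (ℝ × Fib n)) (i : Fin (r + 1)) (A : Fin n)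
    (x : Jet n π r) : dt x (partialq e i A x) = 0 := by
  by_cases h : MDifferentiableAt 𝓘(ℝ, JetModel n r) 𝓘(ℝ, JetModel n r) (Jet.coord e) x
  · by_cases hi : (dcoord e x).IsInvertible
    · rw [dt_eq e h]
      change (dcoord e x ((dcoord e x).inverse (0, qVec i A))).1 = 0
      rw [hi.self_apply_inverse]
    · rw [partialq, ContinuousLinearMap.inverse_of_not_isInvertible hi]
      exact map_zero _
  · have h0 : dcoord e x = 0 := mfderiv_zero_of_not_mdifferentiableAt h
    have : ¬ (dcoord e x).IsInvertible := by
      rintro ⟨f, hf⟩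
      have h1 : f (f.symm ((1, 0) : JetModel n r)) = (1, 0) := f.apply_symm_apply _
      have h2 : f (f.symm ((1, 0) : JetModel n r)) = dcoord e x (f.symm (1, 0)) := by
        rw [← hf]; rfl
      rw [h0, h1] at h2
      exact one_ne_zero (congrArg Prod.fst h2)
    rw [partialq, ContinuousLinearMap.inverse_of_not_isInvertible this]
    exact map_zero _

variable (n π r) in
/-- The quotient of the cotangent bundle of `J^r π` by the pull-back of the cotangent bundle of `ℝ`;
the phase space is the one over `J^{k-1} π`. -/
def RestrictedCotangent : Type _ :=
  Σ x : Jet n π r, (CotangentSpace x ⧸ Submodule.span ℝ {dt x})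

namespace RestrictedCotangent

/-- The pairing of a class of covectors with a vertical vector. -/
def pairing {x : Jet n π r} (v : TangentSpace 𝓘(ℝ, JetModel n r) x) (hv : dt x v = 0) :
    (CotangentSpace x ⧸ Submodule.span ℝ {dt x}) →ₗ[ℝ] ℝ :=
  Submodule.liftQ _
    { toFun := fun α => α v, map_add' := fun _ _ => rfl, map_smul' := fun _ _ => rfl }
    (by
      rw [Submodule.span_singleton_le_iff_mem]
      exact hv)

/-- The natural coordinates `p_A^i` of a class `[α]`, that is `p_A^i = α(∂/∂q_i^A)`. -/
def momentum (e : OpenPartialHomeomorph E (ℝ × Fib n)) (a : RestrictedCotangent n π r) :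
    JetFib n r :=
  fun i A => pairing (partialq e i A a.1) (dt_partialq e i A a.1) a.2

/-- The natural coordinates `((t, q_i^A), p_A^i)`. -/
def coord (e : OpenPartialHomeomorph E (ℝ × Fib n)) (a : RestrictedCotangent n π r) :
    JetModel n r × JetFib n r := (a.1.coord e, a.momentum e)

/-- The class of `∑ p_A^i dq_i^A` at `x`. -/
def ofMomentum (e : OpenPartialHomeomorph E (ℝ × Fib n)) (x : Jet n π r) (p : JetFib n r) :
    RestrictedCotangent n π r :=
  ⟨x, Submodule.Quotient.mk (∑ i, ∑ A, p i A • dq e i A x)⟩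

theorem momentum_mk (e : OpenPartialHomeomorph E (ℝ × Fib n)) (x : Jet n π r)
    (α : CotangentSpace x) (i : Fin (r + 1)) (A : Fin n) :
    momentum e (⟨x, Submodule.Quotient.mk α⟩ : RestrictedCotangent n π r) i A =
      α (partialq e i A x) := rfl

theorem momentum_ofMomentum' (e e' : OpenPartialHomeomorph E (ℝ × Fib n)) (x : Jet n π r)
    (p : JetFib n r) (i : Fin (r + 1)) (A : Fin n) :
    (ofMomentum e x p).momentum e' i A = ∑ j, ∑ B, p j B * dq e j B x (partialq e' i A x) := by
  rw [ofMomentum, momentum_mk]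
  change (∑ j, ∑ B, p j B • dq e j B x : TangentSpace 𝓘(ℝ, JetModel n r) x →L[ℝ] ℝ) _ = _
  simp only [_root_.sum_apply]
  rfl

theorem momentum_ofMomentum {e : OpenPartialHomeomorph E (ℝ × Fib n)} (he : IsAdapted π e)
    {x : Jet n π r} (hx : x.base ∈ e.source) (p : JetFib n r) :
    (ofMomentum e x p).momentum e = p := by
  funext i A
  rw [momentum_ofMomentum']
  have h : ∀ j B, dq e j B x (partialq e i A x) = qVec i A j B := by
    intro j B
    rw [dq_eq e (mdifferentiableAt_coord he hx), partialq,
      (dcoord_isInvertible he hx).self_apply_inverse]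
  simp only [h, qVec]
  rw [Finset.sum_eq_single i, Finset.sum_eq_single A]
  · simp
  · intro B _ hB
    simp [hB]
  · simp
  · intro j _ hj
    simp [hj]
  · simp

theorem ofMomentum_momentum {e : OpenPartialHomeomorph E (ℝ × Fib n)} (he : IsAdapted π e)
    {a : RestrictedCotangent n π r} (hx : a.1.base ∈ e.source) :
    ofMomentum e a.1 (a.momentum e) = a := by
  obtain ⟨x, c⟩ := a
  obtain ⟨α, rfl⟩ := Submodule.Quotient.mk_surjective _ c
  change Sigma.mk x _ = Sigma.mk x _
  congr 1
  rw [Submodule.Quotient.eq, Submodule.mem_span_singleton]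
  have hd := mdifferentiableAt_coord he hx
  have hinv := dcoord_isInvertible he hx
  refine ⟨-α ((dcoord e x).inverse (1, 0)), ?_⟩
  refine ContinuousLinearMap.ext fun v => ?_
  obtain ⟨w, rfl⟩ : ∃ w, (dcoord e x).inverse w = v :=
    ⟨dcoord e x v, hinv.inverse_apply_self v⟩
  have hw : w = w.1 • ((1, 0) : JetModel n r) +
      ∑ i, ∑ A, w.2 i A • ((0, qVec i A) : JetModel n r) := by
    refine Prod.ext ?_ ?_
    · simp [Prod.fst_sum]
    · funext j B
      simp [Prod.snd_sum, Finset.sum_apply, qVec, Pi.single_apply, apply_ite]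
  have hαw : α ((dcoord e x).inverse w) = w.1 • α ((dcoord e x).inverse (1, 0)) +
      ∑ i, ∑ A, w.2 i A • α (partialq e i A x) := by
    conv_lhs => rw [hw]
    simp only [map_add, map_sum, map_smul]
    rfl
  have hdt : dt x ((dcoord e x).inverse w) = w.1 := by
    rw [dt_eq e hd]
    change (dcoord e x ((dcoord e x).inverse w)).1 = _
    rw [hinv.self_apply_inverse]
  have hdq : ∀ i A, dq e i A x ((dcoord e x).inverse w) = w.2 i A := by
    intro i A
    rw [dq_eq e hd, hinv.self_apply_inverse]
  change -α ((dcoord e x).inverse (1, 0)) * dt x ((dcoord e x).inverse w) =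
    (∑ i, ∑ A, α (partialq e i A x) • dq e i A x : TangentSpace 𝓘(ℝ, JetModel n r) x →L[ℝ] ℝ)
      ((dcoord e x).inverse w) - α ((dcoord e x).inverse w)
  have hsum : (∑ i, ∑ A, α (partialq e i A x) • dq e i A x :
      TangentSpace 𝓘(ℝ, JetModel n r) x →L[ℝ] ℝ) ((dcoord e x).inverse w) =
      ∑ i, ∑ A, α (partialq e i A x) * dq e i A x ((dcoord e x).inverse w) := by
    simp only [_root_.sum_apply]
    rfl
  rw [hsum, hαw, hdt]
  simp only [hdq, smul_eq_mul]
  rw [Finset.sum_congr rfl fun i _ => Finset.sum_congr rfl fun A _ => mul_comm _ _]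
  ring

/-- The natural chart. The point `a₀` only fixes the value of the inverse off the target. -/
def chart (a₀ : RestrictedCotangent n π r) {e : OpenPartialHomeomorph E (ℝ × Fib n)}
    (he : IsAdapted π e) :
    PartialEquiv (RestrictedCotangent n π r) (JetModel n r × JetFib n r) where
  toFun := coord e
  invFun w := ofMomentum e ((Jet.chart a₀.1 he).symm w.1) w.2
  source := {a | a.1.base ∈ e.source}
  target := {w | (w.1.1, w.1.2 0) ∈ e.target}
  map_source' := fun _ ha => (Jet.chart a₀.1 he).map_source ha
  map_target' := fun _ hw => (Jet.chart a₀.1 he).map_target hw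
  left_inv' := by
    intro a ha
    change ofMomentum e ((Jet.chart a₀.1 he).symm (Jet.chart a₀.1 he a.1)) (a.momentum e) = a
    rw [(Jet.chart a₀.1 he).left_inv ha]
    exact ofMomentum_momentum he ha
  right_inv' := by
    intro w hw
    exact Prod.ext ((Jet.chart a₀.1 he).right_inv hw)
      (momentum_ofMomentum he ((Jet.chart a₀.1 he).map_target hw) _)

theorem trans_source (a₀ a₁ : RestrictedCotangent n π r)
    {e e' : OpenPartialHomeomorph E (ℝ × Fib n)} (he : IsAdapted π e) (he' : IsAdapted π e') :
    ((chart a₀ he).symm.trans (chart a₁ he')).source =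
      Prod.fst ⁻¹' {z | (z.1, z.2 0) ∈ (e.symm.trans e').source} := by
  rw [← Jet.trans_source a₀.1 a₁.1 he he']
  ext w
  simp only [PartialEquiv.trans_source, mem_inter_iff, mem_preimage]
  rfl

theorem dq_partialq_eq_fderiv (y₀ y₁ : Jet n π r)
    {e e' : OpenPartialHomeomorph E (ℝ × Fib n)} (he : IsAdapted π e) (he' : IsAdapted π e')
    {x : Jet n π r} (hx : x.base ∈ e.source) (hx' : x.base ∈ e'.source)
    (j : Fin (r + 1)) (B : Fin n) (i : Fin (r + 1)) (A : Fin n) :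
    dq e j B x (partialq e' i A x) =
      (fderiv ℝ ((Jet.chart y₁ he').symm.trans (Jet.chart y₀ he)) (x.coord e')
        (0, qVec i A)).2 j B := by
  rw [dq_eq e (mdifferentiableAt_coord he hx)]
  set T := (Jet.chart y₁ he').symm.trans (Jet.chart y₀ he) with hTdef
  have hz : x.coord e' ∈ {z : JetModel n r | (z.1, z.2 0) ∈ (e'.symm.trans e).source} := by
    change ((x.coord e').1, (x.coord e').2 0) ∈ (e'.symm.trans e).source
    rw [Jet.coord_zero he' hx', OpenPartialHomeomorph.trans_source]
    refine ⟨e'.map_source hx', ?_⟩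
    rw [mem_preimage, e'.left_inv hx']
    exact hx
  have hopen : IsOpen {z : JetModel n r | (z.1, z.2 0) ∈ (e'.symm.trans e).source} :=
    (e'.symm.trans e).open_source.preimage (by fun_prop)
  have hT : HasFDerivAt T (fderiv ℝ T (x.coord e')) (x.coord e') :=
    (((Jet.trans_contDiffOn y₁ y₀ he' he).contDiffAt (hopen.mem_nhds hz)).differentiableAt
      (by simp)).hasFDerivAt
  have hc := hT.hasMFDerivAt.comp x (mdifferentiableAt_coord he' hx').hasMFDerivAt
  have heq : Jet.coord e =ᶠ[𝓝 x] T ∘ Jet.coord e' := by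
    filter_upwards [(Jet.openChart y₁ he').open_source.mem_nhds hx'] with y hy
    change Jet.coord e y = Jet.coord e ((Jet.chart y₁ he').symm (Jet.chart y₁ he' y))
    rw [(Jet.chart y₁ he').left_inv hy]
  have hfin := (hc.congr_of_eventuallyEq heq).mfderiv
  have h2 : dcoord e x (partialq e' i A x) =
      fderiv ℝ T (x.coord e') (dcoord e' x (partialq e' i A x)) := DFunLike.congr_fun hfin _
  rw [h2, partialq, (dcoord_isInvertible he' hx').self_apply_inverse]

theorem trans_contDiffOn (a₀ a₁ : RestrictedCotangent n π r)
    {e e' : OpenPartialHomeomorph E (ℝ × Fib n)} (he : IsAdapted π e) (he' : IsAdapted π e') :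
    ContDiffOn ℝ ∞ ((chart a₀ he).symm.trans (chart a₁ he'))
      (Prod.fst ⁻¹' {z | (z.1, z.2 0) ∈ (e.symm.trans e').source}) := by
  set S : Set (JetModel n r) := {z | (z.1, z.2 0) ∈ (e.symm.trans e').source} with hS
  set S' : Set (JetModel n r) := {z | (z.1, z.2 0) ∈ (e'.symm.trans e).source} with hS'
  set T := (Jet.chart a₀.1 he).symm.trans (Jet.chart a₁.1 he') with hT
  set T' := (Jet.chart a₁.1 he').symm.trans (Jet.chart a₀.1 he) with hT'
  have hTs : ContDiffOn ℝ ∞ T S := Jet.trans_contDiffOn _ _ he he'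
  have hTs' : ContDiffOn ℝ ∞ T' S' := Jet.trans_contDiffOn _ _ he' he
  have hopen : IsOpen S' := (e'.symm.trans e).open_source.preimage (by fun_prop)
  have hD : ContDiffOn ℝ ∞ (fderiv ℝ T') S' := hTs'.fderiv_of_isOpen hopen (by simp)
  have hmem : ∀ z ∈ S, ((Jet.chart a₀.1 he).symm z).base ∈ e.source ∧
      ((Jet.chart a₀.1 he).symm z).base ∈ e'.source := by
    intro z hz
    rw [hS, ← Jet.trans_source a₀.1 a₁.1 he he', PartialEquiv.trans_source] at hz
    exact ⟨(Jet.chart a₀.1 he).map_target hz.1, hz.2⟩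
  have hmaps : MapsTo T S S' := by
    intro z hz
    have h1 := hmem z hz
    change ((Jet.coord e' ((Jet.chart a₀.1 he).symm z)).1,
      (Jet.coord e' ((Jet.chart a₀.1 he).symm z)).2 0) ∈ (e'.symm.trans e).source
    rw [Jet.coord_zero he' h1.2, OpenPartialHomeomorph.trans_source]
    refine ⟨e'.map_source h1.2, ?_⟩
    rw [mem_preimage, e'.left_inv h1.2]
    exact h1.1
  have hDT : ContDiffOn ℝ ∞ (fun w : JetModel n r × JetFib n r => fderiv ℝ T' (T w.1))
      (Prod.fst ⁻¹' S) := (hD.comp hTs hmaps).comp contDiffOn_fst (fun _ h => h)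
  have hfin : ContDiffOn ℝ ∞ (fun w : JetModel n r × JetFib n r => (T w.1,
      fun (i : Fin (r + 1)) (A : Fin n) =>
        ∑ j, ∑ B, w.2 j B * (fderiv ℝ T' (T w.1) (0, qVec i A)).2 j B)) (Prod.fst ⁻¹' S) := by
    refine (hTs.comp contDiffOn_fst (fun _ h => h)).prodMk
      (contDiffOn_pi.2 fun i => contDiffOn_pi.2 fun A => ?_)
    refine ContDiffOn.sum fun j _ => ContDiffOn.sum fun B _ => ContDiffOn.mul ?_ ?_
    · fun_prop
    · exact contDiffOn_pi.1 (contDiffOn_pi.1 (hDT.clm_apply contDiffOn_const).snd j) B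
  refine hfin.congr fun w hw => ?_
  refine Prod.ext rfl ?_
  funext i A
  have h1 := hmem w.1 hw
  change (ofMomentum e ((Jet.chart a₀.1 he).symm w.1) w.2).momentum e' i A = _
  rw [momentum_ofMomentum']
  refine Finset.sum_congr rfl fun j _ => Finset.sum_congr rfl fun B _ => ?_
  rw [dq_partialq_eq_fderiv a₀.1 a₁.1 he he' h1.1 h1.2]
  rfl

variable (n π r) in
open Classical in
/-- The atlas of natural charts, which gives the quotient bundle its topology and smooth structure. -/
def core :
    ChartedSpaceCore (JetModel n r × JetFib n r) (RestrictedCotangent n π r) where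
  atlas := {f | ∃ (a₀ : RestrictedCotangent n π r) (e : OpenPartialHomeomorph E (ℝ × Fib n))
    (he : IsAdapted π e), f = chart a₀ he}
  chartAt a := chart a (IsFibered.exists_adapted (π := π) a.1.base).choose_spec.1
  mem_chart_source a := (IsFibered.exists_adapted (π := π) a.1.base).choose_spec.2
  chart_mem_atlas a := ⟨a, _, (IsFibered.exists_adapted (π := π) a.1.base).choose_spec.1, rfl⟩
  open_source := by
    rintro _ _ ⟨y₀, e, he, rfl⟩ ⟨y₁, e', he', rfl⟩
    rw [trans_source]
    exact ((e.symm.trans e').open_source.preimage (by fun_prop)).preimage continuous_fst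
  continuousOn_toFun := by
    rintro _ _ ⟨y₀, e, he, rfl⟩ ⟨y₁, e', he', rfl⟩
    rw [trans_source]
    exact (trans_contDiffOn y₀ y₁ he he').continuousOn

instance : TopologicalSpace (RestrictedCotangent n π r) := (core n π r).toTopologicalSpace

instance : ChartedSpace (JetModel n r × JetFib n r) (RestrictedCotangent n π r) :=
  (core n π r).toChartedSpace

instance : IsManifold 𝓘(ℝ, JetModel n r × JetFib n r) ∞ (RestrictedCotangent n π r) := by
  refine isManifold_of_contDiffOn _ _ _ ?_
  intro f f' hf hf'
  obtain ⟨_, ⟨f₀, rfl⟩, _, ⟨⟨y₀, e, he, rfl⟩, rfl⟩, rfl⟩ := hf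
  obtain ⟨_, ⟨f₁, rfl⟩, _, ⟨⟨y₁, e', he', rfl⟩, rfl⟩, rfl⟩ := hf'
  have h1 := trans_contDiffOn y₀ y₁ he he'
  rw [← trans_source y₀ y₁ he he'] at h1
  simp only [modelWithCornersSelf_coe, modelWithCornersSelf_coe_symm, Function.comp_id,
    Function.id_comp, preimage_id, range_id, inter_univ]
  exact h1

end RestrictedCotangent

end Bundles

section Prolongation

open Classical in
/-- The same section at the instant `s`, if it is defined around `s`. -/
def LocalSection.shift (σ : LocalSection n π) (s : ℝ) : LocalSection n π :=
  if h : ∀ᶠ u in 𝓝 s, ContMDiffAt 𝓘(ℝ, ℝ) 𝓘(ℝ, ℝ × Fib n) ∞ σ.toFun u ∧ π (σ.toFun u) = u then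
    ⟨s, σ.toFun, h⟩
  else σ

/-- The prolongation `j^r φ`, as a curve `s ↦ j^r_s φ` defined around the instant of `φ`. -/
def LocalSection.prolong (r : ℕ) (σ : LocalSection n π) (s : ℝ) : Jet n π r :=
  Jet.ofSection r (σ.shift s)

theorem LocalSection.shift_eventually (σ : LocalSection n π) :
    ∀ᶠ s in 𝓝 σ.time, (σ.shift s).time = s ∧ (σ.shift s).toFun = σ.toFun := by
  filter_upwards [eventually_eventually_nhds.2 σ.isSection] with s hs
  rw [LocalSection.shift, dif_pos hs]
  exact ⟨rfl, rfl⟩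

theorem LocalSection.shift_time (σ : LocalSection n π) : σ.shift σ.time = σ := by
  rw [LocalSection.shift, dif_pos σ.isSection]

theorem LocalSection.prolong_time (r : ℕ) (σ : LocalSection n π) :
    σ.prolong r σ.time = Jet.ofSection r σ := by
  rw [LocalSection.prolong, σ.shift_time]

/-- The projection `J^N π → J^r π` for `r ≤ N`. -/
def Jet.proj (r : ℕ) {N : ℕ} (y : Jet n π N) : Jet n π r := y.rep.prolong r y.rep.time

theorem Jet.proj_self {r : ℕ} (y : Jet n π r) : y.proj r = y := by
  rw [Jet.proj, LocalSection.prolong_time, Jet.ofSection_rep]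

theorem Jet.proj_ofSection {r N : ℕ} (h : r ≤ N) (σ : LocalSection n π) :
    (Jet.ofSection N σ).proj r = Jet.ofSection r σ := by
  rw [Jet.proj, LocalSection.prolong_time]
  obtain ⟨h1, h2, h3⟩ := Jet.rep_rel (r := N) σ
  exact Quotient.sound (s := jetSetoid n π r)
    ⟨h1, h2, fun e he hs i hi => h3 e he hs i (hi.trans h)⟩

theorem LocalSection.coord_prolong {e : OpenPartialHomeomorph E (ℝ × Fib n)} (he : IsAdapted π e)
    (r : ℕ) (σ : LocalSection n π) (hs : σ.toFun σ.time ∈ e.source) :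
    (fun s => (σ.prolong r s).coord e) =ᶠ[𝓝 σ.time] fun s =>
      (s, fun i : Fin (r + 1) => iteratedDeriv i (fibCurve e σ.toFun) s) := by
  filter_upwards [σ.shift_eventually, σ.eventually_source hs] with s h1 h2
  rw [LocalSection.prolong, Jet.coord_ofSection he, h1.1, h1.2]
  rwa [h1.1, h1.2]

variable [IsFibered n π]

theorem LocalSection.prolong_mdifferentiableAt (r : ℕ) (σ : LocalSection n π) :
    MDifferentiableAt 𝓘(ℝ, ℝ) 𝓘(ℝ, JetModel n r) (σ.prolong r) σ.time := by
  obtain ⟨e, he, hs⟩ := IsFibered.exists_adapted (n := n) (π := π) (σ.toFun σ.time)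
  have hc := σ.coord_prolong he r hs
  have hd : DifferentiableAt ℝ (fun s => (σ.prolong r s).coord e) σ.time := by
    rw [hc.differentiableAt_iff]
    refine differentiableAt_id.prodMk (differentiableAt_pi.2 fun i => ?_)
    have hsm : ContDiffAt ℝ ∞ (fibCurve e σ.toFun) σ.time := (σ.smooth_pair he hs).snd
    rw [iteratedDeriv_eq_equiv_comp]
    have h1 : ContDiffAt ℝ 1 (iteratedFDeriv ℝ i (fibCurve e σ.toFun)) σ.time :=
      hsm.iteratedFDeriv_right (by exact_mod_cast le_top)
    exact (LinearIsometryEquiv.differentiableAt _).comp _ (h1.differentiableAt (by simp))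
  set y₀ := σ.prolong r σ.time with hy₀
  have hb : ∀ᶠ s in 𝓝 σ.time, (σ.prolong r s).base ∈ e.source := by
    filter_upwards [σ.shift_eventually, σ.eventually_source hs] with s h1 h2
    rw [LocalSection.prolong, Jet.base_ofSection, h1.1, h1.2]
    exact h2
  have h1 : MDifferentiableAt 𝓘(ℝ, JetModel n r) 𝓘(ℝ, JetModel n r)
      (Jet.openChart y₀ he).symm ((σ.prolong r σ.time).coord e) :=
    (mdifferentiable_of_mem_atlas (Jet.openChart_mem_atlas y₀ he)).mdifferentiableAt_symm
      ((Jet.openChart y₀ he).map_source hb.self_of_nhds)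
  have h2 := h1.comp σ.time hd.mdifferentiableAt
  refine h2.congr_of_eventuallyEq ?_
  filter_upwards [hb] with s h3
  exact ((Jet.openChart y₀ he).left_inv h3).symm

/-- The image of `∂/∂t` under the tangent map of `j^r φ`, where `φ` represents `y`: for
`r + 1 ≤ N` this is the holonomic lift, which depends on `y` only. -/
def Jet.velocity (r : ℕ) {N : ℕ} (y : Jet n π N) : TangentSpace 𝓘(ℝ, JetModel n r) (y.proj r) :=
  mfderiv 𝓘(ℝ, ℝ) 𝓘(ℝ, JetModel n r) (y.rep.prolong r) y.rep.time (1 : ℝ)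

theorem Jet.dt_velocity (r : ℕ) {N : ℕ} (y : Jet n π N) : dt (y.proj r) (y.velocity r) = 1 := by
  have hs := y.rep.prolong_mdifferentiableAt r
  have ht : MDifferentiableAt 𝓘(ℝ, JetModel n r) 𝓘(ℝ, ℝ) (Jet.time (n := n) (π := π) (r := r))
      (y.rep.prolong r y.rep.time) := by
    obtain ⟨e, he, hx⟩ := IsFibered.exists_adapted (n := n) (π := π)
      (y.rep.prolong r y.rep.time).base
    have := mdifferentiableAt_coord he hx
    exact (differentiableAt_fst.mdifferentiableAt (f := (Prod.fst : JetModel n r → ℝ))).comp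
      _ this
  have hc := (ht.hasMFDerivAt.comp _ hs.hasMFDerivAt).mfderiv
  have heq : (Jet.time ∘ y.rep.prolong r) =ᶠ[𝓝 y.rep.time] id := by
    filter_upwards [y.rep.shift_eventually] with s h1
    simp only [Function.comp, LocalSection.prolong, Jet.time_ofSection, h1.1, id]
  have h1 := heq.mfderiv_eq (I := 𝓘(ℝ, ℝ)) (I' := 𝓘(ℝ, ℝ))
  rw [hc, mfderiv_id] at h1
  exact DFunLike.congr_fun h1 (1 : ℝ)

end Prolongation

section Forms
variable {V H M : Type*} [NormedAddCommGroup V] [NormedSpace ℝ V] [TopologicalSpace H]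
  (I : ModelWithCorners ℝ V H) [TopologicalSpace M] [ChartedSpace H M]

/-- The local expression of a one-form in the preferred chart at `x₀`. -/
def oneFormInChart (θ : ∀ x : M, TangentSpace I x →L[ℝ] ℝ) (x₀ : M) (z : V) : V →L[ℝ] ℝ :=
  (θ ((extChartAt I x₀).symm z)).comp (mfderiv 𝓘(ℝ, V) I (extChartAt I x₀).symm z)

/-- The exterior derivative of a one-form on a manifold without boundary, computed in the preferred
chart at the point: `dθ(u, v) = (D_u θ)(v) - (D_v θ)(u)`. -/
def exteriorDeriv (θ : ∀ x : M, TangentSpace I x →L[ℝ] ℝ) (x : M) (u v : TangentSpace I x) : ℝ :=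
  let u' : V := mfderiv I 𝓘(ℝ, V) (extChartAt I x) x u
  let v' : V := mfderiv I 𝓘(ℝ, V) (extChartAt I x) x v
  fderiv ℝ (oneFormInChart I θ x) (extChartAt I x x) u' v' -
    fderiv ℝ (oneFormInChart I θ x) (extChartAt I x x) v' u'

/-- `X` is a smooth vector field. -/
def IsSmoothVectorField [IsManifold I 1 M] (X : ∀ x : M, TangentSpace I x) : Prop :=
  ContMDiff I I.tangent ∞ (fun x => (⟨x, X x⟩ : TangentBundle I M))

end Forms

section Dynamics
variable [IsFibered n π]

/-- The model of the cotangent bundle of `J^r π`. -/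
abbrev cotangentModel (n r : ℕ) :=
  𝓘(ℝ, JetModel n r).prod 𝓘(ℝ, JetModel n r →L[ℝ] ℝ)

/-- The model of the quotient bundle of the cotangent bundle of `J^r π`. -/
abbrev restrictedModel (n r : ℕ) := 𝓘(ℝ, JetModel n r × JetFib n r)

/-- The tautological one-form `Θ` of the cotangent bundle of `J^r π`. -/
def tautologicalForm {r : ℕ} (α : Cotangent n π r) :
    TangentSpace (cotangentModel n r) α →L[ℝ] ℝ :=
  ContinuousLinearMap.comp (α.2 : CotangentSpace α.1)
    (mfderiv (cotangentModel n r) 𝓘(ℝ, JetModel n r)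
      (Bundle.TotalSpace.proj : Cotangent n π r → Jet n π r) α)

/-- The canonical symplectic form `Ω = -dΘ` of the cotangent bundle of `J^r π`. -/
def symplecticForm {r : ℕ} (α : Cotangent n π r) (u v : TangentSpace (cotangentModel n r) α) : ℝ :=
  -exteriorDeriv (cotangentModel n r) tautologicalForm α u v

/-- The quotient map `μ`. -/
def mu {r : ℕ} (α : Cotangent n π r) : RestrictedCotangent n π r :=
  ⟨α.1, Submodule.Quotient.mk (α.2 : CotangentSpace α.1)⟩

/-- The projection `τ̄` to `ℝ`. -/
def tauBar {r : ℕ} (a : RestrictedCotangent n π r) : ℝ := a.1.time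

/-- The total time derivative: `(d_T f)(j^{r+1}_t φ) = d/dt (f ∘ j^r φ)`. -/
def totalDeriv {r : ℕ} (f : Jet n π r → ℝ) (y : Jet n π (r + 1)) : ℝ :=
  deriv (fun s => f (y.rep.prolong r s)) y.time

/-- The iterated total time derivative `d_T^i f`. -/
def iteratedTotalDeriv {r : ℕ} (f : Jet n π r → ℝ) : (i : ℕ) → Jet n π (r + i) → ℝ
  | 0 => f
  | i + 1 => totalDeriv (iteratedTotalDeriv f i)

/-- The partial derivative `∂f/∂q_i^A`. -/
def jetPartialDeriv {r : ℕ} (e : OpenPartialHomeomorph E (ℝ × Fib n)) (i : Fin (r + 1)) (A : Fin n)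
    (f : Jet n π r → ℝ) (y : Jet n π r) : ℝ :=
  mfderiv 𝓘(ℝ, JetModel n r) 𝓘(ℝ, ℝ) f y (partialq e i A y)

variable {m : ℕ}

/-- The Jacobi-Ostrogradsky momenta of a Lagrangian of order `k = m + 1`, with `r = i + 1`:
`p_A^{r-1} = ∑_{j=0}^{k-r} (-1)^j d_T^j (∂L/∂q_{r+j}^A)`. -/
def jacobiMomentum (L : Jet n π (m + 1) → ℝ) (e : OpenPartialHomeomorph E (ℝ × Fib n))
    (y : Jet n π (2 * m + 1)) (i : Fin (m + 1)) (A : Fin n) : ℝ :=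
  ∑ j : Fin (m + 1 - i), (-1 : ℝ) ^ (j : ℕ) *
    iteratedTotalDeriv (jetPartialDeriv e ⟨i + 1 + j, by omega⟩ A L) j (y.proj (m + 1 + j))

variable (n π) in
/-- An adapted chart around `x`. -/
def adaptedChartAt (x : E) : OpenPartialHomeomorph E (ℝ × Fib n) :=
  (IsFibered.exists_adapted (n := n) (π := π) x).choose

/-- The restricted Legendre-Ostrogradsky map `J^{2k-1} π → J^{k-1} π^*` with `k = m + 1`: over
`π^{2k-1}_{k-1}(y)`, the class of `∑ p_A^i dq_i^A` for the Jacobi-Ostrogradsky momenta `p_A^i` at `y`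
(the class is the same for all adapted charts around the point). -/
def legendre (L : Jet n π (m + 1) → ℝ) (y : Jet n π (2 * m + 1)) : RestrictedCotangent n π m :=
  .ofMomentum (adaptedChartAt n π y.base) (y.proj m) (jacobiMomentum L (adaptedChartAt n π y.base) y)

/-- `L` is hyperregular: its restricted Legendre-Ostrogradsky map is a diffeomorphism. -/
def IsHyperregular (L : Jet n π (m + 1) → ℝ) : Prop :=
  ∃ Φ : Diffeomorph 𝓘(ℝ, JetModel n (2 * m + 1)) (restrictedModel n m)
    (Jet n π (2 * m + 1)) (RestrictedCotangent n π m) ∞, ∀ y, Φ y = legendre L y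

/-- The inverse of the restricted Legendre-Ostrogradsky map. -/
def IsHyperregular.legendreInv {L : Jet n π (m + 1) → ℝ} (hL : IsHyperregular L)
    (a : RestrictedCotangent n π m) : Jet n π (2 * m + 1) := hL.choose.symm a

theorem IsHyperregular.legendre_legendreInv {L : Jet n π (m + 1) → ℝ} (hL : IsHyperregular L)
    (a : RestrictedCotangent n π m) : legendre L (hL.legendreInv a) = a := by
  rw [← hL.choose_spec, IsHyperregular.legendreInv, Diffeomorph.apply_symm_apply]

/-- The coupling function `Ĉ(y, α) = α(T(j^{k-1} φ)(∂/∂t))`, where `φ` represents `y`. -/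
def coupling (y : Jet n π (2 * m + 1)) (α : CotangentSpace (y.proj m)) : ℝ := α (y.velocity m)

/-- Over each `(y, [α])` there is exactly one covector with `Ĉ = L`. -/
theorem existsUnique_coupling_eq (L : Jet n π (m + 1) → ℝ) (y : Jet n π (2 * m + 1))
    (c : CotangentSpace (y.proj m) ⧸ Submodule.span ℝ {dt (y.proj m)}) :
    ∃! α : CotangentSpace (y.proj m),
      Submodule.Quotient.mk α = c ∧ coupling y α = L (y.proj (m + 1)) := by
  obtain ⟨β, rfl⟩ := Submodule.Quotient.mk_surjective _ c
  have hv := y.dt_velocity m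
  refine ⟨β + (L (y.proj (m + 1)) - β (y.velocity m)) • dt (y.proj m), ⟨?_, ?_⟩, ?_⟩
  · rw [Submodule.Quotient.eq, add_sub_cancel_left]
    exact Submodule.smul_mem _ _ (Submodule.mem_span_singleton_self _)
  · change β (y.velocity m) + (L (y.proj (m + 1)) - β (y.velocity m)) *
      dt (y.proj m) (y.velocity m) = _
    rw [hv]
    ring
  · rintro γ ⟨h1, h2⟩
    rw [Submodule.Quotient.eq, Submodule.mem_span_singleton] at h1
    obtain ⟨c, hc⟩ := h1
    have h3 : γ = β + c • dt (y.proj m) := by rw [hc]; abel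
    have h4 : coupling y γ = β (y.velocity m) + c * dt (y.proj m) (y.velocity m) := by
      rw [h3]; rfl
    rw [hv, h2] at h4
    rw [h3, h4]
    congr 2
    ring

/-- The section `ĥ` defined by the Hamiltonian submanifold `Ĉ = L` of the unified phase space: it maps
`(y, [α])` to `y` and the unique covector in the class `[α]` whose coupling with `y` is `L`. -/
def hamiltonianLift (L : Jet n π (m + 1) → ℝ) (y : Jet n π (2 * m + 1))
    (c : CotangentSpace (y.proj m) ⧸ Submodule.span ℝ {dt (y.proj m)}) : CotangentSpace (y.proj m) :=
  (existsUnique_coupling_eq L y c).choose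

/-- The Hamiltonian section `h` of `μ`: the covector part of `ĥ(y, [α])`, where `y` is the
point with Legendre image `[α]`. -/
def hamiltonianSection {L : Jet n π (m + 1) → ℝ} (hL : IsHyperregular L)
    (a : RestrictedCotangent n π m) : Cotangent n π m :=
  ⟨(hL.legendreInv a).proj m,
    hamiltonianLift L (hL.legendreInv a) (legendre L (hL.legendreInv a)).2⟩

/-- `h` is a section of `μ`. -/
theorem mu_hamiltonianSection {L : Jet n π (m + 1) → ℝ} (hL : IsHyperregular L)
    (a : RestrictedCotangent n π m) : mu (hamiltonianSection hL a) = a := by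
  refine Eq.trans ?_ (hL.legendre_legendreInv a)
  exact congrArg (Sigma.mk _) (existsUnique_coupling_eq L (hL.legendreInv a) _).choose_spec.1.1

/-- The Hamilton-Cartan form `Ω_h`, the pull-back by `h` of the canonical symplectic form. -/
def hamiltonCartanTwoForm {L : Jet n π (m + 1) → ℝ} (hL : IsHyperregular L)
    (a : RestrictedCotangent n π m) (u v : TangentSpace (restrictedModel n m) a) : ℝ :=
  symplecticForm (hamiltonianSection hL a)
    (mfderiv (restrictedModel n m) (cotangentModel n m) (hamiltonianSection hL) a u)
    (mfderiv (restrictedModel n m) (cotangentModel n m) (hamiltonianSection hL) a v)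

/-- The local Hamiltonian function in the natural coordinates of an adapted chart:
`H = ∑_{i=0}^{k-1} p_A^i q_{i+1}^A - L`, with `q_1, …, q_k` and `L` taken at the Legendre preimage. -/
def localHamiltonian {L : Jet n π (m + 1) → ℝ} (hL : IsHyperregular L)
    (e : OpenPartialHomeomorph E (ℝ × Fib n)) (a : RestrictedCotangent n π m) : ℝ :=
  (∑ i : Fin (m + 1), ∑ A : Fin n,
    a.momentum e i A * ((hL.legendreInv a).coord e).2 ⟨i + 1, by omega⟩ A) -
    L ((hL.legendreInv a).proj (m + 1))

/-- The derivative of `f` at `a` in natural coordinates, in the coordinate direction `w`. -/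
def RestrictedCotangent.partialDeriv {r : ℕ} {e : OpenPartialHomeomorph E (ℝ × Fib n)}
    (he : IsAdapted π e) (w : JetModel n r × JetFib n r) (f : RestrictedCotangent n π r → ℝ)
    (a : RestrictedCotangent n π r) : ℝ :=
  fderiv ℝ (f ∘ (RestrictedCotangent.chart a he).symm) (a.coord e) w

end Dynamics

end HigherOrderMechanics

end

open HigherOrderMechanics

open Set Filter Manifold
open scoped Topology ContDiff
noncomputable section
namespace HigherOrderMechanics
variable {n : ℕ} {E : Type*} [TopologicalSpace E] [ChartedSpace (ℝ × Fib n) E] {π : E → ℝ}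
  [IsFibered n π]

/-! ### Natural charts of the jet spaces, the projections between them, and the holonomic lift. -/

section Jets
variable {r : ℕ}

/-! Everything rests on one coordinate formula. Let `k = m + 1`. The covector h at a point of
J^{k-1}π^* is fixed by two data: its values on the vectors ∂/∂q_i^A are the momenta p_A^i, because h
is a section of μ, and its value on the holonomic lift ∂/∂t + ∑ q_{i+1}^A ∂/∂q_i^A is L. These
vectors form a basis, so h = -H dt + ∑ p_A^i dq_i^A (`hamiltonianSection_snd`). Of the Legendre map
only this enters: it is a diffeomorphism that covers the projection to J^{k-1}π. Hence h and H are
smooth.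

By the tautological property h^*Θ = -H dt + ∑ p_A^i dq_i^A, and the exterior derivative commutes
with pull-back (`exteriorDeriv_mfderiv`), so Ω_h = ∑ dq_i^A ∧ dp_A^i + dH ∧ dt
(`hamiltonCartanTwoForm_eq`). Let dt(u) = 1. Contracting i(u)Ω_h = 0 with ∂/∂p_A^i and ∂/∂q_i^A
forces u = ∂/∂t + ∑ (∂H/∂p_A^i) ∂/∂q_i^A - ∑ (∂H/∂q_i^A) ∂/∂p_A^i. Conversely this u lies in the
kernel: the remaining contraction, with ∂/∂t, vanishes by itself, since the products of partial
derivatives cancel in dH(u) (`hamiltonCartanTwoForm_eq_zero_iff`).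

A section has dt(ψ') = 1, so conditions 2 and 3 agree instant by instant. The kernel vector with dt
= 1 is unique and its characterization mentions no chart, so these vectors form a global smooth
field (`hamiltonVectorField`), and 3 says that ψ is an integral curve of it. In the other direction,
any field as in 4 equals ψ' along ψ. Conditions 1 and 3 agree because Ω_h is antisymmetric and every
tangent vector extends to a smooth field (`RestrictedCotangent.exists_vectorField`); the extension
multiplies by a bump function, which is where Hausdorffness enters. -/

theorem Jet.contMDiffOn_coord {e : OpenPartialHomeomorph E (ℝ × Fib n)} (he : IsAdapted π e) :
    ContMDiffOn 𝓘(ℝ, JetModel n r) 𝓘(ℝ, JetModel n r) ∞ (Jet.coord e)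
      {y : Jet n π r | y.base ∈ e.source} := by
  rintro x hx
  exact contMDiffOn_of_mem_maximalAtlas
    (IsManifold.subset_maximalAtlas (Jet.openChart_mem_atlas x he)) x hx

theorem Jet.isOpen_base_preimage {e : OpenPartialHomeomorph E (ℝ × Fib n)} (he : IsAdapted π e) :
    IsOpen {y : Jet n π r | y.base ∈ e.source} := by
  -- A natural chart carries a jet as default value off its target, so a chart is available only
  -- once some jet exists.
  rcases isEmpty_or_nonempty (Jet n π r) with h | ⟨⟨y₀⟩⟩
  · exact isOpen_discrete _
  · exact (Jet.openChart y₀ he).open_source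

theorem Jet.contMDiffAt_coord {e : OpenPartialHomeomorph E (ℝ × Fib n)} (he : IsAdapted π e)
    {x : Jet n π r} (hx : x.base ∈ e.source) :
    ContMDiffAt 𝓘(ℝ, JetModel n r) 𝓘(ℝ, JetModel n r) ∞ (Jet.coord e) x :=
  (Jet.contMDiffOn_coord he).contMDiffAt ((Jet.isOpen_base_preimage he).mem_nhds hx)

theorem Jet.eventually_base_mem {e : OpenPartialHomeomorph E (ℝ × Fib n)} (he : IsAdapted π e)
    {x : Jet n π r} (hx : x.base ∈ e.source) : ∀ᶠ y in 𝓝 x, y.base ∈ e.source :=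
  (Jet.isOpen_base_preimage he).mem_nhds hx

theorem Jet.contMDiffAt_chart_symm (y₀ : Jet n π r) {e : OpenPartialHomeomorph E (ℝ × Fib n)}
    (he : IsAdapted π e) {z : JetModel n r} (hz : (z.1, z.2 0) ∈ e.target) :
    ContMDiffAt 𝓘(ℝ, JetModel n r) 𝓘(ℝ, JetModel n r) ∞ (Jet.chart y₀ he).symm z :=
  (contMDiffOn_symm_of_mem_maximalAtlas (IsManifold.subset_maximalAtlas
    (Jet.openChart_mem_atlas y₀ he))).contMDiffAt ((Jet.openChart y₀ he).open_target.mem_nhds hz)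

/-- A map into a jet space is smooth at a point if its natural coordinates are and its base
point stays in the domain of the chart. -/
theorem Jet.contMDiffAt_of_coord {V H M : Type*} [NormedAddCommGroup V] [NormedSpace ℝ V]
    [TopologicalSpace H] {I : ModelWithCorners ℝ V H} [TopologicalSpace M] [ChartedSpace H M]
    {f : M → Jet n π r} {x : M} {e : OpenPartialHomeomorph E (ℝ × Fib n)} (he : IsAdapted π e)
    (hb : ∀ᶠ u in 𝓝 x, (f u).base ∈ e.source)
    (hf : ContMDiffAt I 𝓘(ℝ, JetModel n r) ∞ (fun u => (f u).coord e) x) :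
    ContMDiffAt I 𝓘(ℝ, JetModel n r) ∞ f x := by
  have h1 := (Jet.contMDiffAt_chart_symm (f x) he
    (Jet.coord_mem_target he hb.self_of_nhds)).comp x hf
  refine h1.congr_of_eventuallyEq ?_
  filter_upwards [hb] with u hu
  exact ((Jet.chart (f x) he).left_inv hu).symm

omit [IsFibered n π] in
theorem Jet.base_proj {N : ℕ} (y : Jet n π N) : (y.proj r).base = y.base := by
  rw [Jet.proj, LocalSection.prolong_time, Jet.base_ofSection]
  rfl

omit [IsFibered n π] in
theorem Jet.coord_proj {N : ℕ} (h : r ≤ N) {e : OpenPartialHomeomorph E (ℝ × Fib n)}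
    (he : IsAdapted π e) {y : Jet n π N} (hy : y.base ∈ e.source) :
    (y.proj r).coord e = ((y.coord e).1, fun i => (y.coord e).2 (Fin.castLE (by omega) i)) := by
  rw [Jet.proj, LocalSection.prolong_time, Jet.coord_ofSection he _ hy]
  rfl

theorem Jet.contMDiff_proj {N : ℕ} (h : r ≤ N) :
    ContMDiff 𝓘(ℝ, JetModel n N) 𝓘(ℝ, JetModel n r) ∞ (Jet.proj r : Jet n π N → Jet n π r) := by
  intro y
  obtain ⟨e, he, hy⟩ := IsFibered.exists_adapted (n := n) (π := π) y.base
  have hev := Jet.eventually_base_mem he hy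
  refine Jet.contMDiffAt_of_coord he (hev.mono fun u hu => by rwa [Jet.base_proj]) ?_
  -- In natural coordinates the projection is a linear truncation.
  have hl : ContDiff ℝ ∞ (fun z : JetModel n N =>
      (z.1, fun i : Fin (r + 1) => z.2 (Fin.castLE (by omega) i))) := by fun_prop
  refine (hl.contMDiff.contMDiffAt.comp y (Jet.contMDiffAt_coord he hy)).congr_of_eventuallyEq ?_
  filter_upwards [hev] with u hu
  exact Jet.coord_proj h he hu

/-- The holonomic lift in natural coordinates is `∂/∂t + ∑ q_{i+1}^A ∂/∂q_i^A`. -/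
theorem Jet.dcoord_velocity {N : ℕ} (h : r + 1 ≤ N) {e : OpenPartialHomeomorph E (ℝ × Fib n)}
    (he : IsAdapted π e) {y : Jet n π N} (hy : y.base ∈ e.source) :
    dcoord e (y.proj r) (y.velocity r) =
      (1, fun i : Fin (r + 1) => (y.coord e).2 ⟨i + 1, by omega⟩) := by
  have hs : y.rep.toFun y.rep.time ∈ e.source := hy
  have hd := y.rep.prolong_mdifferentiableAt r
  have hb : (y.rep.prolong r y.rep.time).base ∈ e.source := by
    rw [LocalSection.prolong_time, Jet.base_ofSection]; exact hs
  have hcomp := (mdifferentiableAt_coord he hb).hasMFDerivAt.comp y.rep.time hd.hasMFDerivAt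
  have heq := y.rep.coord_prolong he r hs
  let D : ℝ →L[ℝ] JetModel n r := (dcoord e (y.rep.prolong r y.rep.time)).comp
    (mfderiv 𝓘(ℝ, ℝ) 𝓘(ℝ, JetModel n r) (y.rep.prolong r) y.rep.time)
  have h1 : HasFDerivAt (fun s => (y.rep.prolong r s).coord e) D y.rep.time := hcomp.hasFDerivAt
  have h2 := h1.hasDerivAt.congr_of_eventuallyEq heq.symm
  have hsm : ContDiffAt ℝ ∞ (fibCurve e y.rep.toFun) y.rep.time := (y.rep.smooth_pair he hs).snd
  -- Differentiation moves the index from `i` to `i + 1`; as `i ≤ r` and `r + 1 ≤ N`, the result is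
  -- still a coordinate of `y`.
  have h3 : HasDerivAt (fun s => (s, fun i : Fin (r + 1) =>
      iteratedDeriv i (fibCurve e y.rep.toFun) s))
      (1, fun i : Fin (r + 1) => iteratedDeriv (i + 1) (fibCurve e y.rep.toFun) y.rep.time)
      y.rep.time := by
    refine (hasDerivAt_id _).prodMk (hasDerivAt_pi.2 fun i => ?_)
    rw [iteratedDeriv_succ]
    refine DifferentiableAt.hasDerivAt ?_
    rw [iteratedDeriv_eq_equiv_comp]
    have h1 : ContDiffAt ℝ 1 (iteratedFDeriv ℝ i (fibCurve e y.rep.toFun)) y.rep.time :=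
      hsm.iteratedFDeriv_right (by exact_mod_cast le_top)
    exact (LinearIsometryEquiv.differentiableAt _).comp _ (h1.differentiableAt (by simp))
  exact h2.unique h3

end Jets

/-! ### Natural charts and separation of the phase space. -/

section Restricted
variable {r : ℕ}

namespace RestrictedCotangent

/-- The natural chart as a homeomorphism between open sets. -/
def openChart (a₀ : RestrictedCotangent n π r) {e : OpenPartialHomeomorph E (ℝ × Fib n)}
    (he : IsAdapted π e) :
    OpenPartialHomeomorph (RestrictedCotangent n π r) (JetModel n r × JetFib n r) :=
  (core n π r).openPartialHomeomorph (chart a₀ he) ⟨a₀, e, he, rfl⟩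

theorem openChart_mem_maximalAtlas (a₀ : RestrictedCotangent n π r)
    {e : OpenPartialHomeomorph E (ℝ × Fib n)} (he : IsAdapted π e) :
    openChart a₀ he ∈ IsManifold.maximalAtlas (restrictedModel n r) ∞
      (RestrictedCotangent n π r) :=
  IsManifold.subset_maximalAtlas (mem_iUnion.2 ⟨_, mem_iUnion.2 ⟨⟨a₀, e, he, rfl⟩, rfl⟩⟩)

theorem isOpen_base_preimage {e : OpenPartialHomeomorph E (ℝ × Fib n)} (he : IsAdapted π e) :
    IsOpen {a : RestrictedCotangent n π r | a.1.base ∈ e.source} := by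
  rcases isEmpty_or_nonempty (RestrictedCotangent n π r) with h | ⟨⟨y₀⟩⟩
  · exact isOpen_discrete _
  · exact (openChart y₀ he).open_source

theorem eventually_base_mem {e : OpenPartialHomeomorph E (ℝ × Fib n)} (he : IsAdapted π e)
    {a : RestrictedCotangent n π r} (ha : a.1.base ∈ e.source) :
    ∀ᶠ b in 𝓝 a, b.1.base ∈ e.source :=
  (isOpen_base_preimage he).mem_nhds ha

theorem contMDiffAt_coord {e : OpenPartialHomeomorph E (ℝ × Fib n)} (he : IsAdapted π e)
    {a : RestrictedCotangent n π r} (ha : a.1.base ∈ e.source) :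
    ContMDiffAt (restrictedModel n r) 𝓘(ℝ, JetModel n r × JetFib n r) ∞ (coord e) a :=
  (contMDiffOn_of_mem_maximalAtlas (openChart_mem_maximalAtlas a he)).contMDiffAt
    ((openChart a he).open_source.mem_nhds ha)

theorem contMDiffAt_chart_symm (a₀ : RestrictedCotangent n π r)
    {e : OpenPartialHomeomorph E (ℝ × Fib n)} (he : IsAdapted π e)
    {w : JetModel n r × JetFib n r} (hw : (w.1.1, w.1.2 0) ∈ e.target) :
    ContMDiffAt 𝓘(ℝ, JetModel n r × JetFib n r) (restrictedModel n r) ∞ (chart a₀ he).symm w :=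
  (contMDiffOn_symm_of_mem_maximalAtlas (openChart_mem_maximalAtlas a₀ he)).contMDiffAt
    ((openChart a₀ he).open_target.mem_nhds hw)

theorem coord_mem_target {e : OpenPartialHomeomorph E (ℝ × Fib n)} (he : IsAdapted π e)
    {a : RestrictedCotangent n π r} (ha : a.1.base ∈ e.source) :
    ((a.coord e).1.1, (a.coord e).1.2 0) ∈ e.target := Jet.coord_mem_target he ha

theorem contMDiff_fst : ContMDiff (restrictedModel n r) 𝓘(ℝ, JetModel n r) ∞
    (fun b : RestrictedCotangent n π r => b.1) := by
  intro a
  obtain ⟨e, he, ha⟩ := IsFibered.exists_adapted (n := n) (π := π) a.1.base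
  refine Jet.contMDiffAt_of_coord he (eventually_base_mem he ha) ?_
  exact (contDiff_fst.contMDiff.contMDiffAt (f := (Prod.fst :
    JetModel n r × JetFib n r → JetModel n r))).comp a (contMDiffAt_coord he ha)

/-- The differential at `a` of the natural coordinate system. -/
def dcoord (e : OpenPartialHomeomorph E (ℝ × Fib n)) (a : RestrictedCotangent n π r) :
    TangentSpace (restrictedModel n r) a →L[ℝ] JetModel n r × JetFib n r :=
  mfderiv (restrictedModel n r) 𝓘(ℝ, JetModel n r × JetFib n r) (coord e) a

theorem hasMFDerivAt_coord {e : OpenPartialHomeomorph E (ℝ × Fib n)} (he : IsAdapted π e)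
    {a : RestrictedCotangent n π r} (ha : a.1.base ∈ e.source) :
    HasMFDerivAt (restrictedModel n r) 𝓘(ℝ, JetModel n r × JetFib n r) (coord e) a
      (dcoord e a) :=
  ((contMDiffAt_coord he ha).mdifferentiableAt (by simp)).hasMFDerivAt

theorem mdifferentiable_openChart (a₀ : RestrictedCotangent n π r)
    {e : OpenPartialHomeomorph E (ℝ × Fib n)} (he : IsAdapted π e) :
    (openChart a₀ he).MDifferentiable (restrictedModel n r) 𝓘(ℝ, JetModel n r × JetFib n r) :=
  mdifferentiable_of_mem_atlas (mem_iUnion.2 ⟨_, mem_iUnion.2 ⟨⟨a₀, e, he, rfl⟩, rfl⟩⟩)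

theorem dcoord_isInvertible {e : OpenPartialHomeomorph E (ℝ × Fib n)} (he : IsAdapted π e)
    {a : RestrictedCotangent n π r} (ha : a.1.base ∈ e.source) : (dcoord e a).IsInvertible :=
  ⟨(mdifferentiable_openChart a he).mfderiv ha, rfl⟩

/-- Both sides differentiate the same function, the jet coordinates of the foot point, once through
the projection and once through the chart of the phase space. -/
theorem mfderiv_fst {e : OpenPartialHomeomorph E (ℝ × Fib n)} (he : IsAdapted π e)
    {a : RestrictedCotangent n π r} (ha : a.1.base ∈ e.source)
    (v : TangentSpace (restrictedModel n r) a) :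
    HigherOrderMechanics.dcoord e a.1 (mfderiv (restrictedModel n r) 𝓘(ℝ, JetModel n r)
      (fun b : RestrictedCotangent n π r => b.1) a v) = (dcoord e a v).1 := by
  have h1 := (mdifferentiableAt_coord he ha).hasMFDerivAt.comp a
    ((contMDiff_fst (r := r) a).mdifferentiableAt (by simp)).hasMFDerivAt
  have h2 := ((ContinuousLinearMap.fst ℝ (JetModel n r) (JetFib n r)).hasFDerivAt
    (x := a.coord e)).hasMFDerivAt.comp a (hasMFDerivAt_coord he ha)
  exact DFunLike.congr_fun (hasMFDerivAt_unique h1 h2) v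

/-- Needed for bump functions, whose extension by zero is smooth only on a Hausdorff space. Two
points over distinct points of E are separated by open sets pulled back from E, the map to E being
`e.symm (t, q_0)` locally and so continuous. Two points over the same point of E lie in one natural
chart and are separated there. -/
instance [T2Space E] : T2Space (RestrictedCotangent n π r) := by
  refine ⟨fun a b hab => ?_⟩
  have hbase : Continuous fun a : RestrictedCotangent n π r => a.1.base := by
    refine continuous_iff_continuousAt.2 fun a => ?_
    obtain ⟨e, he, ha⟩ := IsFibered.exists_adapted (n := n) (π := π) a.1.base
    have h1 : ContinuousAt (fun a => e.symm ((coord e a).1.1, (coord e a).1.2 0)) a := by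
      have h2 : ContinuousAt (fun a : RestrictedCotangent n π r =>
          ((coord e a).1.1, (coord e a).1.2 0)) a := by
        have h3 := (contMDiffAt_coord he ha).continuousAt
        have h4 : Continuous fun w : JetModel n r × JetFib n r => (w.1.1, w.1.2 0) := by fun_prop
        exact h4.continuousAt.comp h3
      exact (e.continuousAt_symm (coord_mem_target he ha)).comp_of_eq h2 rfl
    refine h1.congr ?_
    filter_upwards [eventually_base_mem he ha] with b hb
    have := Jet.coord_zero he hb
    change e.symm ((b.1.coord e).1, (b.1.coord e).2 0) = _
    rw [this, e.left_inv hb]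
  by_cases h : a.1.base = b.1.base
  · obtain ⟨e, he, ha⟩ := IsFibered.exists_adapted (n := n) (π := π) a.1.base
    obtain ⟨u, v, hu, hv, h1, h2, h3⟩ := t2_separation
      ((openChart a he).injOn.ne ha (show b.1.base ∈ e.source from h ▸ ha) hab)
    refine ⟨_, _, (openChart a he).isOpen_inter_preimage hu,
      (openChart a he).isOpen_inter_preimage hv, ⟨ha, h1⟩,
      ⟨show b.1.base ∈ e.source from h ▸ ha, h2⟩, ?_⟩
    exact (h3.preimage (openChart a he)).mono inter_subset_right inter_subset_right
  · obtain ⟨u, v, hu, hv, h1, h2, h3⟩ := t2_separation h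
    exact ⟨_, _, hu.preimage hbase, hv.preimage hbase, h1, h2, h3.preimage _⟩

end RestrictedCotangent

end Restricted

/-! ### The Hamiltonian section in natural coordinates. -/

section Hamiltonian
variable {m : ℕ}

/-- The one-form `-H dt + ∑ p_A^i dq_i^A` on the model of the jet space. -/
def coordForm {r : ℕ} (H : ℝ) (p : JetFib n r) : JetModel n r →L[ℝ] ℝ :=
  -H • ContinuousLinearMap.fst ℝ ℝ (JetFib n r) +
    ∑ i, ∑ A, p i A • ((ContinuousLinearMap.proj A).comp
      ((ContinuousLinearMap.proj i).comp (ContinuousLinearMap.snd ℝ ℝ (JetFib n r))))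

theorem coordForm_apply {r : ℕ} (H : ℝ) (p : JetFib n r) (w : JetModel n r) :
    coordForm H p w = -H * w.1 + ∑ i, ∑ A, p i A * w.2 i A := by
  simp [coordForm, _root_.sum_apply]

theorem contDiff_coordForm {r : ℕ} :
    ContDiff ℝ ∞ (fun w : ℝ × JetFib n r => coordForm w.1 w.2) := by
  unfold coordForm
  fun_prop

variable {L : Jet n π (m + 1) → ℝ}

/-- The Legendre map covers the projection to J^{k-1}π by construction, hence its inverse lands in
the fibre over the foot point of `a`. The equality is only propositional, which is why several later
proofs transport along it. -/
theorem IsHyperregular.proj_legendreInv (hL : IsHyperregular L) (a : RestrictedCotangent n π m) :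
    (hL.legendreInv a).proj m = a.1 :=
  congrArg Sigma.fst (hL.legendre_legendreInv a)

theorem IsHyperregular.base_legendreInv (hL : IsHyperregular L) (a : RestrictedCotangent n π m) :
    (hL.legendreInv a).base = a.1.base := by
  rw [← hL.proj_legendreInv a, Jet.base_proj]

theorem hamiltonianSection_fst (hL : IsHyperregular L) (a : RestrictedCotangent n π m) :
    (hamiltonianSection hL a).1 = a.1 := hL.proj_legendreInv a

/-- Since ∂/∂q_i^A is annihilated by dt, the value depends on the class alone, and the class of h(a)
is `a`. -/
theorem hamiltonianSection_partialq (hL : IsHyperregular L)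
    (e : OpenPartialHomeomorph E (ℝ × Fib n)) (a : RestrictedCotangent n π m) (i : Fin (m + 1))
    (A : Fin n) :
    ((hamiltonianSection hL a).2 : CotangentSpace _) (partialq e i A (hamiltonianSection hL a).1) =
      a.momentum e i A := by
  conv_rhs => rw [← mu_hamiltonianSection hL a]
  rfl

theorem hamiltonianSection_velocity (hL : IsHyperregular L) (a : RestrictedCotangent n π m) :
    ((hamiltonianSection hL a).2 : CotangentSpace ((hL.legendreInv a).proj m))
      ((hL.legendreInv a).velocity m) = L ((hL.legendreInv a).proj (m + 1)) :=
  (existsUnique_coupling_eq L (hL.legendreInv a) _).choose_spec.1.2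

/-- In natural coordinates `h = -H dt + ∑ p_A^i dq_i^A`. -/
theorem hamiltonianSection_snd (hL : IsHyperregular L) {e : OpenPartialHomeomorph E (ℝ × Fib n)}
    (he : IsAdapted π e) {a : RestrictedCotangent n π m} (ha : a.1.base ∈ e.source)
    (v : TangentSpace 𝓘(ℝ, JetModel n m) (hamiltonianSection hL a).1) :
    ((hamiltonianSection hL a).2 : CotangentSpace _) v =
      coordForm (localHamiltonian hL e a) (a.momentum e)
        (dcoord e (hamiltonianSection hL a).1 v) := by
  have hy : (hL.legendreInv a).base ∈ e.source := by rwa [hL.base_legendreInv]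
  have hx : (hamiltonianSection hL a).1.base ∈ e.source := by rwa [hamiltonianSection_fst]
  set α : CotangentSpace (hamiltonianSection hL a).1 := (hamiltonianSection hL a).2 with hα
  let vel : TangentSpace 𝓘(ℝ, JetModel n m) (hamiltonianSection hL a).1 :=
    (hL.legendreInv a).velocity m
  have hvel : dcoord e (hamiltonianSection hL a).1 vel =
      (1, fun i : Fin (m + 1) => ((hL.legendreInv a).coord e).2 ⟨i + 1, by omega⟩) :=
    Jet.dcoord_velocity (by omega) he hy
  have hαvel : α vel = L ((hL.legendreInv a).proj (m + 1)) := hamiltonianSection_velocity hL a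
  have hinv := dcoord_isInvertible he hx
  set w := dcoord e (hamiltonianSection hL a).1 v with hw
  have hpq : ∀ i A, dcoord e (hamiltonianSection hL a).1
      (partialq e i A (hamiltonianSection hL a).1) = (0, qVec i A) :=
    fun i A => hinv.self_apply_inverse _
  -- The holonomic lift has dt = 1 and the ∂/∂q_i^A span the kernel of dt, so together they form a
  -- basis on which the covector is known.
  have hv : v = w.1 • vel + ∑ i, ∑ A, (w.2 i A - w.1 *
      ((hL.legendreInv a).coord e).2 ⟨i + 1, by omega⟩ A) •
        partialq e i A (hamiltonianSection hL a).1 := by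
    refine hinv.injective ?_
    simp only [map_add, map_sum, map_smul, hvel, hpq, ← hw]
    refine Prod.ext ?_ ?_
    · simp [Prod.fst_sum]
    · funext j B
      simp [Prod.snd_sum, Finset.sum_apply, qVec, Pi.single_apply, apply_ite]
  have h1 : α v = w.1 * L ((hL.legendreInv a).proj (m + 1)) + ∑ i, ∑ A, (w.2 i A - w.1 *
      ((hL.legendreInv a).coord e).2 ⟨i + 1, by omega⟩ A) * a.momentum e i A := by
    conv_lhs => rw [hv]
    simp only [map_add, map_sum, map_smul, hαvel, smul_eq_mul]
    simp only [hα, hamiltonianSection_partialq]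
  -- The coefficient of `w.1` is L - ∑ p_A^i q_{i+1}^A, which is -H.
  rw [h1, coordForm_apply, localHamiltonian]
  simp only [sub_mul, Finset.sum_sub_distrib, neg_sub, Finset.sum_mul]
  have h2 : ∀ i A, w.1 * ((hL.legendreInv a).coord e).2 ⟨(i : Fin (m + 1)) + 1, by omega⟩ A *
      a.momentum e i A = a.momentum e i A *
        ((hL.legendreInv a).coord e).2 ⟨i + 1, by omega⟩ A * w.1 := fun i A => by ring
  have h3 : ∀ i A, w.2 i A * a.momentum e i A = a.momentum e i A * w.2 i A :=
    fun i A => by ring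
  simp only [h2, h3]
  ring

/-- The function is polynomial in the momenta and in the jet coordinates of the Legendre preimage,
minus L at a projection of that preimage; the preimage depends smoothly on the point by
hyperregularity. -/
theorem contMDiffAt_localHamiltonian (hLs : ContMDiff 𝓘(ℝ, JetModel n (m + 1)) 𝓘(ℝ, ℝ) ∞ L)
    (hL : IsHyperregular L) {e : OpenPartialHomeomorph E (ℝ × Fib n)}
    (he : IsAdapted π e) {a : RestrictedCotangent n π m} (ha : a.1.base ∈ e.source) :
    ContMDiffAt (restrictedModel n m) 𝓘(ℝ, ℝ) ∞ (localHamiltonian hL e) a := by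
  have hy : (hL.legendreInv a).base ∈ e.source := by rwa [hL.base_legendreInv]
  have hinv : ContMDiffAt (restrictedModel n m) 𝓘(ℝ, JetModel n (2 * m + 1)) ∞
      hL.legendreInv a := hL.choose.symm.contMDiff a
  have hq := (Jet.contMDiffAt_coord he hy).comp a hinv
  have hp := RestrictedCotangent.contMDiffAt_coord he ha
  have hLc : ContMDiffAt (restrictedModel n m) 𝓘(ℝ, ℝ) ∞
      (fun b => L ((hL.legendreInv b).proj (m + 1))) a :=
    (hLs.comp (Jet.contMDiff_proj (r := m + 1) (N := 2 * m + 1) (by omega))).contMDiffAt.comp a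
      hinv
  have hF : ContDiff ℝ ∞ (fun w : (JetModel n m × JetFib n m) × JetModel n (2 * m + 1) =>
      ∑ i : Fin (m + 1), ∑ A : Fin n, w.1.2 i A * w.2.2 ⟨i + 1, by omega⟩ A) := by fun_prop
  exact (hF.contMDiff.contMDiffAt.comp a (hp.prodMk_space hq)).sub hLc

end Hamiltonian

/-! ### Charts of the cotangent bundle: smoothness of h and the local form of Θ. -/

section CotangentCharts
variable {r : ℕ}

theorem Jet.contMDiffAt_extChartAt_symm {x₀ : Jet n π r} {z : JetModel n r}
    (hz : z ∈ (extChartAt 𝓘(ℝ, JetModel n r) x₀).target) :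
    ContMDiffAt 𝓘(ℝ, JetModel n r) 𝓘(ℝ, JetModel n r) ∞
      (extChartAt 𝓘(ℝ, JetModel n r) x₀).symm z :=
  (contMDiffOn_extChartAt_symm x₀).contMDiffAt ((isOpen_extChartAt_target x₀).mem_nhds hz)

/-- The fibre coordinate of a covector in a chart of the cotangent bundle is its pull-back by the
inverse of the chart of the base. -/
theorem inCoordinates_cotangent {x₀ x : Jet n π r}
    (hx : x ∈ (chartAt (JetModel n r) x₀).source) (α : CotangentSpace x) :
    ContinuousLinearMap.inCoordinates (JetModel n r) (TangentSpace 𝓘(ℝ, JetModel n r)) ℝ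
      (Bundle.Trivial (Jet n π r) ℝ) x₀ x x₀ x α =
      α.comp (mfderiv 𝓘(ℝ, JetModel n r) 𝓘(ℝ, JetModel n r)
        (extChartAt 𝓘(ℝ, JetModel n r) x₀).symm (extChartAt 𝓘(ℝ, JetModel n r) x₀ x)) := by
  -- The bundle of values is trivial, so only the trivialization of the tangent bundle contributes.
  have htriv : (trivializationAt ℝ (Bundle.Trivial (Jet n π r) ℝ) x₀).continuousLinearMapAt ℝ x =
      ContinuousLinearMap.id ℝ ℝ := Bundle.Trivial.continuousLinearMapAt_trivialization ..
  rw [ContinuousLinearMap.inCoordinates, TangentBundle.symmL_trivializationAt hx,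
    ModelWithCorners.range_eq_univ, mfderivWithin_univ]
  exact ContinuousLinearMap.ext fun v => DFunLike.congr_fun htriv _

/-- The foot point of h is the foot point of its argument, so only the fibre coordinate needs work.
By `inCoordinates_cotangent` it is the covector pulled back by the inverse of the preferred chart χ,
and by `hamiltonianSection_snd` this equals (-H dt + ∑ p dq) ∘ DT, where T is the transition from χ
to the natural coordinates. Both factors are smooth. -/
theorem contMDiffAt_hamiltonianSection {m : ℕ} {L : Jet n π (m + 1) → ℝ}
    (hLs : ContMDiff 𝓘(ℝ, JetModel n (m + 1)) 𝓘(ℝ, ℝ) ∞ L) (hL : IsHyperregular L)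
    (a : RestrictedCotangent n π m) :
    ContMDiffAt (restrictedModel n m) (cotangentModel n m) ∞ (hamiltonianSection hL) a := by
  obtain ⟨e, he, ha⟩ := IsFibered.exists_adapted (n := n) (π := π) a.1.base
  rw [contMDiffAt_hom_bundle]
  have hfst : (fun b => (hamiltonianSection hL b).1) = fun b => b.1 :=
    funext (hamiltonianSection_fst hL)
  refine ⟨by rw [hfst]; exact RestrictedCotangent.contMDiff_fst a, ?_⟩
  set x₀ := (hamiltonianSection hL a).1 with hx₀
  let χ := extChartAt 𝓘(ℝ, JetModel n m) x₀
  have hx : x₀.base ∈ e.source := by rwa [hx₀, hamiltonianSection_fst]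
  have hax : a.1 = x₀ := (hamiltonianSection_fst hL a).symm
  let T : JetModel n m → JetModel n m := Jet.coord e ∘ χ.symm
  have hT : ContDiffAt ℝ ∞ T (χ a.1) := by
    rw [← contMDiffAt_iff_contDiffAt]
    refine ContMDiffAt.comp _ ?_
      (Jet.contMDiffAt_extChartAt_symm (by rw [hax]; exact mem_extChartAt_target x₀))
    refine Jet.contMDiffAt_coord he ?_
    rw [hax, extChartAt_to_inv]
    exact hx
  have hT' : ContDiffAt ℝ ∞ (fderiv ℝ T) (χ a.1) := hT.fderiv_right (by simp)
  have hχ : ContMDiffAt (restrictedModel n m) 𝓘(ℝ, JetModel n m) ∞ (fun b => χ b.1) a := by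
    refine ContMDiffAt.comp a ?_ (RestrictedCotangent.contMDiff_fst a)
    rw [hax]
    exact contMDiffAt_extChartAt
  have hγ : ContMDiffAt (restrictedModel n m) 𝓘(ℝ, JetModel n m →L[ℝ] ℝ) ∞
      (fun b => coordForm (localHamiltonian hL e b) (b.momentum e)) a := by
    refine (contDiff_coordForm.contMDiff.contMDiffAt).comp a
      ((contMDiffAt_localHamiltonian hLs hL he ha).prodMk_space ?_)
    exact (contDiff_snd.contMDiff.contMDiffAt (f := (Prod.snd :
      JetModel n m × JetFib n m → JetFib n m))).comp a (RestrictedCotangent.contMDiffAt_coord he ha)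
  have hTb : ContMDiffAt (restrictedModel n m) 𝓘(ℝ, JetModel n m →L[ℝ] JetModel n m) ∞
      (fun b => fderiv ℝ T (χ b.1)) a := hT'.contMDiffAt.comp a hχ
  refine (hγ.clm_comp hTb).congr_of_eventuallyEq ?_
  have hsrc : ∀ᶠ b in 𝓝 a, b.1 ∈ (chartAt (JetModel n m) x₀).source := by
    refine (RestrictedCotangent.contMDiff_fst a).continuousAt
      ((chartAt (JetModel n m) x₀).open_source.mem_nhds ?_)
    rw [hax]
    exact mem_chart_source _ x₀
  filter_upwards [hsrc, RestrictedCotangent.eventually_base_mem he ha] with b hb hbe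
  have hb' : (hamiltonianSection hL b).1 ∈ (chartAt (JetModel n m) x₀).source := by
    rwa [hamiltonianSection_fst]
  have hbe' : (hamiltonianSection hL b).1.base ∈ e.source := by rwa [hamiltonianSection_fst]
  refine (inCoordinates_cotangent hb' _).trans ?_
  rw [← hamiltonianSection_fst hL b]
  set x := (hamiltonianSection hL b).1 with hxdef
  have hxs : χ x ∈ χ.target := χ.map_source (by rwa [extChartAt_source])
  have hxi : χ.symm (χ x) = x := χ.left_inv (by rwa [extChartAt_source])
  have hS := ((Jet.contMDiffAt_extChartAt_symm hxs).mdifferentiableAt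
    (by simp)).hasMFDerivAt
  have hC := mdifferentiableAt_coord he (x := χ.symm (χ x)) (by rw [hxi]; exact hbe')
  have hD := (hC.hasMFDerivAt.comp (χ x) hS).mfderiv
  refine ContinuousLinearMap.ext fun v => ?_
  refine (hamiltonianSection_snd hL he hbe _).trans ?_
  have h2 : fderiv ℝ T (χ x) v = dcoord e x (mfderiv 𝓘(ℝ, JetModel n m) 𝓘(ℝ, JetModel n m)
      χ.symm (χ x) v) := by
    rw [← mfderiv_eq_fderiv, hD, hxi]
    rfl
  exact congrArg _ h2.symm

/-- In a chart of the cotangent bundle the tautological form is `∑ p_A dx^A`. -/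
theorem oneFormInChart_tautologicalForm (α : Cotangent n π r)
    {z : JetModel n r × (JetModel n r →L[ℝ] ℝ)}
    (hz : z ∈ (extChartAt (cotangentModel n r) α).target) :
    oneFormInChart (cotangentModel n r) tautologicalForm α z =
      z.2.comp (ContinuousLinearMap.fst ℝ (JetModel n r) (JetModel n r →L[ℝ] ℝ)) := by
  set χ := extChartAt (cotangentModel n r) α with hχ
  let χ₀ := extChartAt 𝓘(ℝ, JetModel n r) α.1
  have hopen := (isOpen_extChartAt_target (I := cotangentModel n r) α).mem_nhds hz
  -- The chart of the total space covers the chart of the base.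
  have htar : ∀ z ∈ χ.target, z.1 ∈ χ₀.target ∧ (χ.symm z).1 = χ₀.symm z.1 := by
    intro z hz
    have h1 := hz
    rw [hχ, FiberBundle.extChartAt_target] at h1
    refine ⟨h1.1.1, ?_⟩
    have h2 := hz
    rw [hχ, extChartAt_target] at h2
    exact FiberBundle.chartedSpace_chartAt_symm_fst (HB := JetModel n r) α z h2.1
  have hz1 : z.1 ∈ χ₀.target := (htar z hz).1
  have hsymm : MDifferentiableAt 𝓘(ℝ, JetModel n r × (JetModel n r →L[ℝ] ℝ)) (cotangentModel n r)
      χ.symm z :=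
    ((contMDiffOn_extChartAt_symm (n := 1) α).contMDiffAt hopen).mdifferentiableAt (by simp)
  have hproj := ((Bundle.contMDiff_proj (IB := 𝓘(ℝ, JetModel n r)) (n := 1)
    (F := JetModel n r →L[ℝ] ℝ)
    (fun x : Jet n π r => TangentSpace 𝓘(ℝ, JetModel n r) x →L[ℝ] Bundle.Trivial (Jet n π r) ℝ x)
    (χ.symm z)).mdifferentiableAt (by simp)).hasMFDerivAt
  have hc := hproj.comp z hsymm.hasMFDerivAt
  have hc' := ((Jet.contMDiffAt_extChartAt_symm hz1).mdifferentiableAt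
    (by simp)).hasMFDerivAt.comp z ((ContinuousLinearMap.fst ℝ (JetModel n r)
      (JetModel n r →L[ℝ] ℝ)).hasFDerivAt (x := z)).hasMFDerivAt
  -- The two expressions for the differential of the bundle projection, read through the inverse
  -- charts, coincide.
  have heq := hasMFDerivAt_unique hc (hc'.congr_of_eventuallyEq (by
    filter_upwards [hopen] with u hu using (htar u hu).2))
  have hx : (χ.symm z).1 ∈ (chartAt (JetModel n r) α.1).source := by
    rw [(htar z hz).2, ← extChartAt_source 𝓘(ℝ, JetModel n r)]
    exact χ₀.map_target hz1
  -- The fibre coordinate `z.2` is the covector pulled back by the inverse chart of the base, which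
  -- is exactly how Θ evaluates it.
  have hz2 : z.2 = ((χ.symm z).2 : CotangentSpace _).comp
      (mfderiv 𝓘(ℝ, JetModel n r) 𝓘(ℝ, JetModel n r) χ₀.symm (χ₀ (χ.symm z).1)) := by
    rw [← inCoordinates_cotangent hx]
    conv_lhs => rw [← χ.right_inv hz, hχ, FiberBundle.extChartAt]
    rfl
  have hz3 : χ₀ (χ.symm z).1 = z.1 := by
    rw [(htar z hz).2]
    exact χ₀.right_inv hz1
  rw [hz3] at hz2
  refine ContinuousLinearMap.ext fun u => ?_
  refine Eq.trans ?_ (DFunLike.congr_fun hz2 u.1).symm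
  exact congrArg ((χ.symm z).2 : CotangentSpace _) (DFunLike.congr_fun heq u)

end CotangentCharts

/-! ### Naturality of the exterior derivative. -/

section Pullback
variable {V H M W : Type*} [NormedAddCommGroup V] [NormedSpace ℝ V] [TopologicalSpace H]
  {I : ModelWithCorners ℝ V H} [I.Boundaryless] [TopologicalSpace M] [ChartedSpace H M]
  [IsManifold I ∞ M] [NormedAddCommGroup W] [NormedSpace ℝ W]

/-- The exterior derivative of one-forms is natural under pull-back by a smooth map from a normed
space. -/
theorem exteriorDeriv_mfderiv {θ : ∀ x : M, TangentSpace I x →L[ℝ] ℝ} {g : W → M} {w₀ : W}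
    (hg : ContMDiffAt 𝓘(ℝ, W) I ∞ g w₀)
    (hθ : DifferentiableAt ℝ (oneFormInChart I θ (g w₀)) (extChartAt I (g w₀) (g w₀)))
    {η : W → W →L[ℝ] ℝ} (hη : ∀ᶠ w in 𝓝 w₀, ∀ u : W, η w u = θ (g w) (mfderiv 𝓘(ℝ, W) I g w u))
    (u v : W) :
    exteriorDeriv I θ (g w₀) (mfderiv 𝓘(ℝ, W) I g w₀ u) (mfderiv 𝓘(ℝ, W) I g w₀ v) =
      fderiv ℝ η w₀ u v - fderiv ℝ η w₀ v u := by
  let χ := extChartAt I (g w₀)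
  let k : W → V := χ ∘ g
  have hk : ContDiffAt ℝ ∞ k w₀ :=
    contMDiffAt_iff_contDiffAt.1 (contMDiffAt_extChartAt.comp w₀ hg)
  have hk1 : DifferentiableAt ℝ k w₀ := hk.differentiableAt (by simp)
  have hk2 : DifferentiableAt ℝ (fderiv ℝ k) w₀ :=
    (hk.fderiv_right (m := ∞) (by simp)).differentiableAt (by simp)
  have hsrc : ∀ᶠ w in 𝓝 w₀, g w ∈ χ.source :=
    hg.continuousAt (extChartAt_source_mem_nhds (g w₀))
  have hmk : ∀ᶠ w in 𝓝 w₀, MDifferentiableAt 𝓘(ℝ, W) I g w := by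
    have h1 : ContMDiffAt 𝓘(ℝ, W) I 1 g w₀ := hg.of_le (by simp)
    have := IsManifold.of_le (m := 1) (n := ∞) (I := I) (M := M) (by simp)
    exact ((contMDiffAt_iff_contMDiffAt_nhds (by simp)).1 h1).mono fun w hw =>
      hw.mdifferentiableAt (by simp)
  have hkd : mfderiv I 𝓘(ℝ, V) χ (g w₀) ∘L mfderiv 𝓘(ℝ, W) I g w₀ = fderiv ℝ k w₀ := by
    rw [← mfderiv_eq_fderiv]
    exact ((mdifferentiableAt_extChartAt (mem_chart_source H (g w₀))).hasMFDerivAt.comp w₀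
      hmk.self_of_nhds.hasMFDerivAt).mfderiv.symm
  -- Near `w₀` the pulled-back form is the chart expression of θ along `k`, composed with Dk, so the
  -- product rule applies.
  have hloc : η =ᶠ[𝓝 w₀] fun w => (oneFormInChart I θ (g w₀) (k w)).comp (fderiv ℝ k w) := by
    filter_upwards [hη, hsrc.eventually_nhds, hmk] with w h1 h2 h3
    refine ContinuousLinearMap.ext fun u => ?_
    have hi : χ.symm (k w) = g w := χ.left_inv h2.self_of_nhds
    have ht : k w ∈ χ.target := χ.map_source h2.self_of_nhds
    have hs : MDifferentiableAt 𝓘(ℝ, V) I χ.symm (k w) :=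
      ((contMDiffOn_extChartAt_symm (n := 1) (g w₀)).contMDiffAt
        ((isOpen_extChartAt_target (g w₀)).mem_nhds ht)).mdifferentiableAt (by simp)
    have hkw : MDifferentiableAt 𝓘(ℝ, W) 𝓘(ℝ, V) k w :=
      (mdifferentiableAt_extChartAt (by
        rw [← extChartAt_source I]; exact h2.self_of_nhds)).comp w h3
    have hc := (hs.hasMFDerivAt.comp w hkw.hasMFDerivAt).congr_of_eventuallyEq
      (f₁ := g) (by filter_upwards [h2] with x hx using (χ.left_inv hx).symm)
    -- The covectors live in fibres over points that are equal but not syntactically so; this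
    -- identifies them.
    have hu : ∀ x, x = g w → ∀ l : V, θ (g w) l = θ x l := by
      rintro x rfl l
      rfl
    rw [h1 u, hc.mfderiv]
    refine (hu _ hi _).trans ?_
    rw [← mfderiv_eq_fderiv]
    rfl
  have hD : HasFDerivAt η _ w₀ :=
    ((hθ.hasFDerivAt.comp w₀ hk1.hasFDerivAt).clm_comp hk2.hasFDerivAt).congr_of_eventuallyEq hloc
  rw [hD.fderiv]
  -- The product rule leaves a term θ(D²k(u, v)), which cancels in the antisymmetrization because
  -- D²k is symmetric.
  have hsymm : fderiv ℝ (fderiv ℝ k) w₀ u v = fderiv ℝ (fderiv ℝ k) w₀ v u :=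
    (hk.isSymmSndFDerivAt (by
      have h2 : ((2 : ℕ) : WithTop ℕ∞) ≤ ∞ :=
        WithTop.coe_le_coe.2 le_top
      simpa using h2)).eq u v
  have e1 : ∀ w : W, mfderiv I 𝓘(ℝ, V) χ (g w₀) (mfderiv 𝓘(ℝ, W) I g w₀ w) = fderiv ℝ k w₀ w :=
    fun w => DFunLike.congr_fun hkd w
  change fderiv ℝ (oneFormInChart I θ (g w₀)) (χ (g w₀))
      (mfderiv I 𝓘(ℝ, V) χ (g w₀) (mfderiv 𝓘(ℝ, W) I g w₀ u))
      (mfderiv I 𝓘(ℝ, V) χ (g w₀) (mfderiv 𝓘(ℝ, W) I g w₀ v)) -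
    fderiv ℝ (oneFormInChart I θ (g w₀)) (χ (g w₀))
      (mfderiv I 𝓘(ℝ, V) χ (g w₀) (mfderiv 𝓘(ℝ, W) I g w₀ v))
      (mfderiv I 𝓘(ℝ, V) χ (g w₀) (mfderiv 𝓘(ℝ, W) I g w₀ u)) = _
  rw [e1, e1]
  simp [hsymm]
  rfl

end Pullback

/-! ### The Hamilton-Cartan form in natural coordinates. -/

section HamiltonCartan
variable {m : ℕ} {L : Jet n π (m + 1) → ℝ}

/-- In a chart of the cotangent bundle Θ is linear in the fibre coordinate and independent of the
base coordinate. This supplies the regularity that `exteriorDeriv_mfderiv` asks of the form. -/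
theorem differentiableAt_oneFormInChart_tautologicalForm {r : ℕ} (α : Cotangent n π r) :
    DifferentiableAt ℝ (oneFormInChart (cotangentModel n r) tautologicalForm α)
      (extChartAt (cotangentModel n r) α α) := by
  have h : oneFormInChart (cotangentModel n r) tautologicalForm α
      =ᶠ[𝓝 (extChartAt (cotangentModel n r) α α)] fun z =>
        z.2.comp (ContinuousLinearMap.fst ℝ (JetModel n r) (JetModel n r →L[ℝ] ℝ)) := by
    filter_upwards [extChartAt_target_mem_nhds (I := cotangentModel n r) α] with z hz
      using oneFormInChart_tautologicalForm α hz
  rw [h.differentiableAt_iff]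
  exact DifferentiableAt.clm_comp differentiableAt_snd (differentiableAt_const _)

/-- The pull-back of the tautological form by the Hamiltonian section is `-H dt + ∑ p_A^i dq_i^A`. -/
theorem tautologicalForm_mfderiv_hamiltonianSection
    (hLs : ContMDiff 𝓘(ℝ, JetModel n (m + 1)) 𝓘(ℝ, ℝ) ∞ L) (hL : IsHyperregular L)
    {e : OpenPartialHomeomorph E (ℝ × Fib n)} (he : IsAdapted π e)
    {a : RestrictedCotangent n π m} (ha : a.1.base ∈ e.source)
    (v : TangentSpace (restrictedModel n m) a) :
    tautologicalForm (hamiltonianSection hL a) (mfderiv (restrictedModel n m) (cotangentModel n m)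
      (hamiltonianSection hL) a v) =
      coordForm (localHamiltonian hL e a) (a.momentum e)
        (RestrictedCotangent.dcoord e a v).1 := by
  have hh := (contMDiffAt_hamiltonianSection hLs hL a).mdifferentiableAt (by simp)
  have hproj := ((Bundle.contMDiff_proj (IB := 𝓘(ℝ, JetModel n m)) (n := 1)
    (F := JetModel n m →L[ℝ] ℝ)
    (fun x : Jet n π m => TangentSpace 𝓘(ℝ, JetModel n m) x →L[ℝ] Bundle.Trivial (Jet n π m) ℝ x)
    (hamiltonianSection hL a)).mdifferentiableAt (by simp)).hasMFDerivAt
  have hc := hproj.comp a hh.hasMFDerivAt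
  have hfst := ((RestrictedCotangent.contMDiff_fst a).mdifferentiableAt (by simp)).hasMFDerivAt
  -- The bundle projection composed with h is the foot point map, so Θ pairs h(a) with the projected
  -- vector.
  have heq := hasMFDerivAt_unique (hc.congr_of_eventuallyEq
    (Eventually.of_forall fun b => (hamiltonianSection_fst hL b).symm)) hfst
  refine (hamiltonianSection_snd hL he ha _).trans ?_
  rw [← RestrictedCotangent.mfderiv_fst he ha v, ← heq]
  have hx : ∀ x : Jet n π m, x = a.1 → ∀ u : JetModel n m,
      dcoord e x u = dcoord e a.1 u := by
    rintro x rfl u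
    rfl
  exact congrArg _ (hx _ (hamiltonianSection_fst hL a) _)

/-- In natural coordinates `Ω_h = ∑ dq_i^A ∧ dp_A^i + dH ∧ dt`. -/
theorem hamiltonCartanTwoForm_eq
    (hLs : ContMDiff 𝓘(ℝ, JetModel n (m + 1)) 𝓘(ℝ, ℝ) ∞ L) (hL : IsHyperregular L)
    {e : OpenPartialHomeomorph E (ℝ × Fib n)} (he : IsAdapted π e)
    {a : RestrictedCotangent n π m} (ha : a.1.base ∈ e.source)
    (u v : TangentSpace (restrictedModel n m) a) :
    hamiltonCartanTwoForm hL a u v =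
      (∑ i, ∑ A, ((RestrictedCotangent.dcoord e a u).1.2 i A *
          (RestrictedCotangent.dcoord e a v).2 i A -
        (RestrictedCotangent.dcoord e a u).2 i A *
          (RestrictedCotangent.dcoord e a v).1.2 i A)) +
      (RestrictedCotangent.partialDeriv he (RestrictedCotangent.dcoord e a u)
          (localHamiltonian hL e) a * (RestrictedCotangent.dcoord e a v).1.1 -
        RestrictedCotangent.partialDeriv he (RestrictedCotangent.dcoord e a v)
          (localHamiltonian hL e) a * (RestrictedCotangent.dcoord e a u).1.1) := by
  -- Composing h with the inverse natural chart moves the computation to a normed space, where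
  -- naturality of the exterior derivative is available.
  let κ := (RestrictedCotangent.chart a he).symm
  set w₀ := a.coord e with hw₀
  have htar : (w₀.1.1, w₀.1.2 0) ∈ e.target := RestrictedCotangent.coord_mem_target he ha
  have hκ := RestrictedCotangent.contMDiffAt_chart_symm a he htar
  have hκa : κ w₀ = a := (RestrictedCotangent.chart a he).left_inv ha
  let g : JetModel n m × JetFib n m → Cotangent n π m := hamiltonianSection hL ∘ κ
  have hg : ContMDiffAt 𝓘(ℝ, JetModel n m × JetFib n m) (cotangentModel n m) ∞ g w₀ :=
    (contMDiffAt_hamiltonianSection hLs hL (κ w₀)).comp w₀ hκ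
  have hmg : ∀ w : JetModel n m × JetFib n m, (w.1.1, w.1.2 0) ∈ e.target → ∀ u',
      mfderiv 𝓘(ℝ, JetModel n m × JetFib n m) (cotangentModel n m) g w u' =
        mfderiv (restrictedModel n m) (cotangentModel n m) (hamiltonianSection hL) (κ w)
          (mfderiv 𝓘(ℝ, JetModel n m × JetFib n m) (restrictedModel n m) κ w u') := by
    intro w hw u'
    exact DFunLike.congr_fun ((((contMDiffAt_hamiltonianSection hLs hL
      (κ w)).mdifferentiableAt (by simp)).hasMFDerivAt.comp w
      ((RestrictedCotangent.contMDiffAt_chart_symm a he hw).mdifferentiableAt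
        (by simp)).hasMFDerivAt).mfderiv) u'
  let F : JetModel n m × JetFib n m → ℝ := localHamiltonian hL e ∘ κ
  have hF : HasFDerivAt F (fderiv ℝ F w₀) w₀ := by
    have h1 : ContMDiffAt 𝓘(ℝ, JetModel n m × JetFib n m) 𝓘(ℝ, ℝ) ∞ F w₀ := by
      refine ContMDiffAt.comp w₀ ?_ hκ
      rw [hκa]
      exact contMDiffAt_localHamiltonian hLs hL he ha
    exact ((contMDiffAt_iff_contDiffAt.1 h1).differentiableAt (by simp)).hasFDerivAt
  let fst' := ContinuousLinearMap.fst ℝ (JetModel n m) (JetFib n m)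
  let η : JetModel n m × JetFib n m → JetModel n m × JetFib n m →L[ℝ] ℝ :=
    fun w => (coordForm (F w) w.2).comp fst'
  have hη : ∀ᶠ w in 𝓝 w₀, ∀ u', η w u' = tautologicalForm (g w)
      (mfderiv 𝓘(ℝ, JetModel n m × JetFib n m) (cotangentModel n m) g w u') := by
    filter_upwards [(RestrictedCotangent.openChart a he).open_target.mem_nhds htar] with w hw u'
    have hw' : (w.1.1, w.1.2 0) ∈ e.target := hw
    have hκw : (κ w).1.base ∈ e.source := (RestrictedCotangent.chart a he).map_target hw
    have hr : (κ w).coord e = w := (RestrictedCotangent.chart a he).right_inv hw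
    refine Eq.trans ?_ (congrArg (tautologicalForm (g w)) (hmg w hw' u')).symm
    refine Eq.trans ?_ (tautologicalForm_mfderiv_hamiltonianSection hLs hL he hκw _).symm
    have h1 : RestrictedCotangent.dcoord e (κ w)
        (mfderiv 𝓘(ℝ, JetModel n m × JetFib n m) (restrictedModel n m) κ w u') = u' :=
      DFunLike.congr_fun
        ((RestrictedCotangent.mdifferentiable_openChart a he).comp_symm_deriv hw) u'
    rw [h1]
    change coordForm (F w) w.2 u'.1 = coordForm (F w) ((κ w).coord e).2 u'.1
    rw [hr]
  -- The form -H dt + ∑ p dq is linear in the pair (H, p), so its derivative is the same expression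
  -- in the derivative of that pair.
  have hηd : ∀ u' v' : JetModel n m × JetFib n m, fderiv ℝ η w₀ u' v' =
      coordForm (fderiv ℝ F w₀ u') u'.2 v'.1 := by
    intro u' v'
    let B : ℝ × JetFib n m →ₗ[ℝ] (JetModel n m × JetFib n m →L[ℝ] ℝ) :=
      { toFun := fun w => (coordForm w.1 w.2).comp fst'
        map_add' := fun x y => by
          refine ContinuousLinearMap.ext fun z => ?_
          change coordForm _ _ _ = coordForm _ _ _ + coordForm _ _ _
          simp only [coordForm_apply, Prod.fst_add, Prod.snd_add, Pi.add_apply, add_mul,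
            Finset.sum_add_distrib]
          ring
        map_smul' := fun c x => by
          refine ContinuousLinearMap.ext fun z => ?_
          change coordForm _ _ _ = c * coordForm _ _ _
          simp only [coordForm_apply, Prod.smul_fst, Prod.smul_snd, Pi.smul_apply, smul_eq_mul,
            mul_add, Finset.mul_sum, mul_assoc]
          ring }
    have hB : HasFDerivAt η (B.toContinuousLinearMap.comp ((fderiv ℝ F w₀).prod
        (ContinuousLinearMap.snd ℝ (JetModel n m) (JetFib n m)))) w₀ :=
      B.toContinuousLinearMap.hasFDerivAt.comp w₀ (hF.prodMk hasFDerivAt_snd)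
    rw [hB.fderiv]
    rfl
  have key := exteriorDeriv_mfderiv hg
    (differentiableAt_oneFormInChart_tautologicalForm (g w₀)) hη
    (RestrictedCotangent.dcoord e a u) (RestrictedCotangent.dcoord e a v)
  have hsymm : ∀ u' : TangentSpace (restrictedModel n m) a,
      mfderiv 𝓘(ℝ, JetModel n m × JetFib n m) (restrictedModel n m) κ w₀
        (RestrictedCotangent.dcoord e a u') = u' := fun u' => DFunLike.congr_fun
      ((RestrictedCotangent.mdifferentiable_openChart a he).symm_comp_deriv ha) u'
  -- The base point obtained from the chart is `κ w₀`, which equals `a` only propositionally.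
  have htransport : ∀ b, b = a → ∀ u' v' : JetModel n m × JetFib n m,
      hamiltonCartanTwoForm hL a u' v' = hamiltonCartanTwoForm hL b u' v' := by
    rintro b rfl u' v'
    rfl
  -- The outer sign is that of Ω = -dΘ.
  have h1 : hamiltonCartanTwoForm hL a u v =
      -(fderiv ℝ η w₀ (RestrictedCotangent.dcoord e a u) (RestrictedCotangent.dcoord e a v) -
        fderiv ℝ η w₀ (RestrictedCotangent.dcoord e a v) (RestrictedCotangent.dcoord e a u)) :=
    (htransport _ hκa u v).trans <|
      (congrArg₂ (hamiltonCartanTwoForm hL (κ w₀)) (hsymm u) (hsymm v)).symm.trans <|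
      congrArg Neg.neg <| (congrArg₂ (exteriorDeriv (cotangentModel n m) tautologicalForm (g w₀))
        (hmg w₀ htar _) (hmg w₀ htar _)).symm.trans key
  rw [h1, hηd, hηd, coordForm_apply, coordForm_apply]
  change _ = _ + (fderiv ℝ F w₀ (RestrictedCotangent.dcoord e a u) * _ -
    fderiv ℝ F w₀ (RestrictedCotangent.dcoord e a v) * _)
  simp only [Finset.sum_sub_distrib, mul_comm ((RestrictedCotangent.dcoord e a u).1.2 _ _)]
  ring

end HamiltonCartan

/-! ### Smooth vector fields on the phase space. -/

section VectorFields

/-- A section of the tangent bundle whose components in a natural chart are smooth is smooth. -/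
theorem RestrictedCotangent.contMDiffAt_vectorField {r : ℕ}
    {X : (a : RestrictedCotangent n π r) → TangentSpace (restrictedModel n r) a}
    {e : OpenPartialHomeomorph E (ℝ × Fib n)} (he : IsAdapted π e)
    {a₀ : RestrictedCotangent n π r} (ha₀ : a₀.1.base ∈ e.source)
    {F : JetModel n r × JetFib n r → JetModel n r × JetFib n r}
    (hF : ContDiffAt ℝ ∞ F (a₀.coord e))
    (hX : ∀ᶠ a in 𝓝 a₀, RestrictedCotangent.dcoord e a (X a) = F (a.coord e)) :
    ContMDiffAt (restrictedModel n r) (restrictedModel n r).tangent ∞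
      (fun a => (⟨a, X a⟩ : TangentBundle (restrictedModel n r) (RestrictedCotangent n π r))) a₀ := by
  have : IsManifold (restrictedModel n r) 1 (RestrictedCotangent n π r) :=
    IsManifold.of_le (n := ∞) (by simp)
  -- Near `a₀` the field is the pull-back by the natural coordinates of the smooth field `F` on the
  -- model.
  have h1 := ContMDiffAt.mpullback_vectorField_preimage (n := ∞) (m := ∞)
    (V := fun z : JetModel n r × JetFib n r =>
      (F z : TangentSpace 𝓘(ℝ, JetModel n r × JetFib n r) z))
    (contMDiffAt_vectorSpace_iff_contDiffAt.2 hF) (contMDiffAt_coord he ha₀)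
    (dcoord_isInvertible he ha₀) (by simp)
  refine h1.congr_of_eventuallyEq ?_
  filter_upwards [hX, eventually_base_mem he ha₀] with a h2 h3
  refine congrArg (Bundle.TotalSpace.mk a) ?_
  change X a = (dcoord e a).inverse (F (a.coord e))
  rw [← h2, (dcoord_isInvertible he h3).inverse_apply_self]

/-- Every tangent vector of the phase space is the value of a smooth vector field. -/
theorem RestrictedCotangent.exists_vectorField [T2Space E] {r : ℕ}
    (a₀ : RestrictedCotangent n π r) (v : TangentSpace (restrictedModel n r) a₀) :
    ∃ Y : (a : RestrictedCotangent n π r) → TangentSpace (restrictedModel n r) a,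
      IsSmoothVectorField (restrictedModel n r) Y ∧ Y a₀ = v := by
  let he := (IsFibered.exists_adapted (n := n) (π := π) a₀.1.base).choose_spec.1
  let e := (IsFibered.exists_adapted (n := n) (π := π) a₀.1.base).choose
  have hae : a₀.1.base ∈ e.source :=
    (IsFibered.exists_adapted (n := n) (π := π) a₀.1.base).choose_spec.2
  let f : SmoothBumpFunction (restrictedModel n r) a₀ := Classical.arbitrary _
  -- The preferred chart at `a₀` is the natural chart of the chosen adapted chart, so the bump
  -- function is supported in the domain where `W` is smooth.
  have hsrc : (chartAt (JetModel n r × JetFib n r) a₀).source = {a | a.1.base ∈ e.source} := rfl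
  -- Constant components in the chart. Off the chart domain the value is irrelevant, as the bump
  -- function vanishes there.
  let W : (a : RestrictedCotangent n π r) → TangentSpace (restrictedModel n r) a :=
    fun a => (dcoord e a).inverse (dcoord e a₀ v)
  refine ⟨fun a => f a • W a, ?_, ?_⟩
  · refine ContMDiffOn.smul_section_of_tsupport f.contMDiff.contMDiffOn
      (isOpen_base_preimage he) (hsrc ▸ f.tsupport_subset_chartAt_source) fun a ha => ?_
    refine (contMDiffAt_vectorField he ha (F := fun _ => dcoord e a₀ v) contDiffAt_const
      ?_).contMDiffWithinAt
    filter_upwards [eventually_base_mem he ha] with b hb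
    exact (dcoord_isInvertible he hb).self_apply_inverse _
  · change f a₀ • W a₀ = v
    rw [f.eq_one, one_smul]
    exact (dcoord_isInvertible he hae).inverse_apply_self v

end VectorFields

/-! ### The kernel of the Hamilton-Cartan form. -/

section HamiltonVector
variable {m : ℕ} {L : Jet n π (m + 1) → ℝ}

theorem RestrictedCotangent.chart_symm_eq {r : ℕ} (a₀ a₁ : RestrictedCotangent n π r)
    {e : OpenPartialHomeomorph E (ℝ × Fib n)} (he : IsAdapted π e)
    {w : JetModel n r × JetFib n r} (hw : (w.1.1, w.1.2 0) ∈ e.target) :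
    (chart a₀ he).symm w = (chart a₁ he).symm w := by
  change ofMomentum e ((Jet.chart a₀.1 he).symm w.1) w.2 =
    ofMomentum e ((Jet.chart a₁.1 he).symm w.1) w.2
  rw [Jet.chart_symm_apply a₀.1 he hw, Jet.chart_symm_apply a₁.1 he hw]

/-- The definition of `partialDeriv` uses an inverse chart whose default value moves with `a`. With
the default fixed at `a₀`, the partial derivative becomes that of one function, so its smoothness in
`a` can be studied. -/
theorem RestrictedCotangent.partialDeriv_eq {r : ℕ} (a₀ : RestrictedCotangent n π r)
    {e : OpenPartialHomeomorph E (ℝ × Fib n)} (he : IsAdapted π e)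
    {a : RestrictedCotangent n π r} (ha : a.1.base ∈ e.source)
    (w : JetModel n r × JetFib n r) (f : RestrictedCotangent n π r → ℝ) :
    partialDeriv he w f a = fderiv ℝ (f ∘ (chart a₀ he).symm) (a.coord e) w := by
  rw [partialDeriv]
  congr 1
  refine Filter.EventuallyEq.fderiv_eq ?_
  filter_upwards [(openChart a he).open_target.mem_nhds (coord_mem_target he ha)] with z hz
  exact congrArg f (chart_symm_eq a a₀ he hz)

/-- The components `(1, ∂H/∂p_A^i, -∂H/∂q_i^A)` of the Hamiltonian vector field. -/
def hamiltonVec (hL : IsHyperregular L) {e : OpenPartialHomeomorph E (ℝ × Fib n)}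
    (he : IsAdapted π e) (a : RestrictedCotangent n π m) : JetModel n m × JetFib n m :=
  ((1, fun i A => RestrictedCotangent.partialDeriv he (0, qVec i A) (localHamiltonian hL e) a),
    fun i A => -RestrictedCotangent.partialDeriv he ((0, qVec i A), 0) (localHamiltonian hL e) a)

theorem clm_apply_eq_sum {r : ℕ} (l : JetModel n r × JetFib n r →L[ℝ] ℝ)
    (w : JetModel n r × JetFib n r) :
    l w = w.1.1 * l ((1, 0), 0) + (∑ i, ∑ A, w.1.2 i A * l ((0, qVec i A), 0)) +
      ∑ i, ∑ A, w.2 i A * l (0, qVec i A) := by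
  have hw : w = w.1.1 • (((1, 0), 0) : JetModel n r × JetFib n r) +
      (∑ i, ∑ A, w.1.2 i A • (((0, qVec i A), 0) : JetModel n r × JetFib n r)) +
      ∑ i, ∑ A, w.2 i A • ((0, qVec i A) : JetModel n r × JetFib n r) := by
    refine Prod.ext (Prod.ext ?_ ?_) ?_
    · simp [Prod.fst_sum]
    · funext j B
      simp [Prod.snd_sum, Prod.fst_sum, Finset.sum_apply, qVec, Pi.single_apply, apply_ite]
    · funext j B
      simp [Prod.snd_sum, Finset.sum_apply, qVec, Pi.single_apply, apply_ite]
  conv_lhs => rw [hw]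
  simp only [map_add, map_sum, map_smul, smul_eq_mul]

/-- A vector with `dt = 1` lies in the kernel of `Ω_h` if and only if its components are those of
the Hamiltonian vector field. -/
theorem hamiltonCartanTwoForm_eq_zero_iff
    (hLs : ContMDiff 𝓘(ℝ, JetModel n (m + 1)) 𝓘(ℝ, ℝ) ∞ L) (hL : IsHyperregular L)
    {e : OpenPartialHomeomorph E (ℝ × Fib n)} (he : IsAdapted π e)
    {a : RestrictedCotangent n π m} (ha : a.1.base ∈ e.source)
    {u : TangentSpace (restrictedModel n m) a}
    (hu : (RestrictedCotangent.dcoord e a u).1.1 = 1) :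
    (∀ v, hamiltonCartanTwoForm hL a u v = 0) ↔
      RestrictedCotangent.dcoord e a u = hamiltonVec hL he a := by
  have hinv := RestrictedCotangent.dcoord_isInvertible he ha
  have hform := hamiltonCartanTwoForm_eq hLs hL he ha u
  have hsum : ∀ (f : JetFib n m) i A, ∑ j, ∑ B, f j B * (qVec i A : JetFib n m) j B = f i A := by
    intro f i A
    rw [Finset.sum_eq_single i, Finset.sum_eq_single A] <;> simp +contextual [qVec]
  constructor
  · intro h
    refine Prod.ext (Prod.ext hu ?_) ?_
    -- Contraction with ∂/∂p_A^i isolates the q-component of `u`.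
    · funext i A
      have h1 := (hform _).symm.trans (h ((RestrictedCotangent.dcoord e a).inverse (0, qVec i A)))
      rw [hinv.self_apply_inverse, hu] at h1
      simp only [Prod.fst_zero, Prod.snd_zero, Pi.zero_apply, mul_zero, sub_zero, hsum,
        zero_sub, mul_one] at h1
      change _ = RestrictedCotangent.partialDeriv he (0, qVec i A) (localHamiltonian hL e) a
      linarith
    -- Contraction with ∂/∂q_i^A isolates the p-component, with a minus sign.
    · funext i A
      have h1 := (hform _).symm.trans
        (h ((RestrictedCotangent.dcoord e a).inverse ((0, qVec i A), 0)))
      rw [hinv.self_apply_inverse, hu] at h1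
      simp only [Pi.zero_apply, mul_zero, zero_sub, Finset.sum_neg_distrib, hsum, mul_one] at h1
      change _ = -RestrictedCotangent.partialDeriv he ((0, qVec i A), 0) (localHamiltonian hL e) a
      linarith
  · intro h v
    rw [hform, h]
    -- Expand dH in both directions. Along the Hamiltonian vector it reduces to ∂H/∂t because the
    -- products of the q- and p-derivatives cancel; this makes the dt-part of the contraction vanish
    -- too.
    have hlin : ∀ w, RestrictedCotangent.partialDeriv he w (localHamiltonian hL e) a = _ :=
      fun w => clm_apply_eq_sum _ w
    rw [hlin (hamiltonVec hL he a), hlin (RestrictedCotangent.dcoord e a v)]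
    change (∑ i, ∑ A, (RestrictedCotangent.partialDeriv he (0, qVec i A)
        (localHamiltonian hL e) a * _ -
      -RestrictedCotangent.partialDeriv he ((0, qVec i A), 0) (localHamiltonian hL e) a * _)) +
      ((1 * RestrictedCotangent.partialDeriv he ((1, 0), 0) (localHamiltonian hL e) a +
        (∑ i, ∑ A, RestrictedCotangent.partialDeriv he (0, qVec i A) (localHamiltonian hL e) a *
          RestrictedCotangent.partialDeriv he ((0, qVec i A), 0) (localHamiltonian hL e) a) +
        (∑ i, ∑ A, -RestrictedCotangent.partialDeriv he ((0, qVec i A), 0)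
          (localHamiltonian hL e) a *
          RestrictedCotangent.partialDeriv he (0, qVec i A) (localHamiltonian hL e) a)) * _ -
      (_ * RestrictedCotangent.partialDeriv he ((1, 0), 0) (localHamiltonian hL e) a +
        (∑ i, ∑ A, _ * RestrictedCotangent.partialDeriv he ((0, qVec i A), 0)
          (localHamiltonian hL e) a) +
        (∑ i, ∑ A, _ * RestrictedCotangent.partialDeriv he (0, qVec i A)
          (localHamiltonian hL e) a)) * 1) = 0
    have hc : ∀ x y : JetFib n m, (∑ i, ∑ A, x i A * y i A) = ∑ i, ∑ A, y i A * x i A :=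
      fun x y => Finset.sum_congr rfl fun i _ => Finset.sum_congr rfl fun A _ => mul_comm _ _
    simp only [Finset.sum_sub_distrib, neg_mul, Finset.sum_neg_distrib]
    rw [hc fun i A => RestrictedCotangent.partialDeriv he (0, qVec i A) (localHamiltonian hL e) a,
      hc fun i A => RestrictedCotangent.partialDeriv he (0, qVec i A) (localHamiltonian hL e) a,
      hc fun i A => RestrictedCotangent.partialDeriv he ((0, qVec i A), 0)
        (localHamiltonian hL e) a]
    ring

end HamiltonVector

/-! ### The global Hamiltonian vector field. -/

section HamiltonVectorField
variable {m : ℕ} {L : Jet n π (m + 1) → ℝ}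

theorem hamiltonCartanTwoForm_swap (hL : IsHyperregular L) (a : RestrictedCotangent n π m)
    (u v : TangentSpace (restrictedModel n m) a) :
    hamiltonCartanTwoForm hL a u v = -hamiltonCartanTwoForm hL a v u := by
  simp only [hamiltonCartanTwoForm, symplecticForm, exteriorDeriv]
  ring

/-- Homogeneity in one slot is all the linearity required later: the tangent space of the time line
is spanned by ∂/∂t. -/
theorem exteriorDeriv_smul {V H M : Type*} [NormedAddCommGroup V] [NormedSpace ℝ V]
    [TopologicalSpace H] {I : ModelWithCorners ℝ V H} [TopologicalSpace M] [ChartedSpace H M]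
    (θ : ∀ x : M, TangentSpace I x →L[ℝ] ℝ) (x : M) (c : ℝ) (u v : TangentSpace I x) :
    exteriorDeriv I θ x u (c • v) = c * exteriorDeriv I θ x u v := by
  let B := fderiv ℝ (oneFormInChart I θ x) (extChartAt I x x)
  have key : ∀ u' v' : V, B u' (c • v') - B (c • v') u' = c * (B u' v' - B v' u') := by
    intro u' v'
    simp only [map_smul, _root_.smul_apply, smul_eq_mul]
    ring
  have hv : mfderiv I 𝓘(ℝ, V) (extChartAt I x) x (c • v) =
      c • mfderiv I 𝓘(ℝ, V) (extChartAt I x) x v := map_smul _ c v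
  unfold exteriorDeriv
  simp only [hv]
  exact key _ _

theorem hamiltonCartanTwoForm_smul (hL : IsHyperregular L) (a : RestrictedCotangent n π m)
    (c : ℝ) (u v : TangentSpace (restrictedModel n m) a) :
    hamiltonCartanTwoForm hL a u (c • v) = c * hamiltonCartanTwoForm hL a u v := by
  simp only [hamiltonCartanTwoForm, symplecticForm, map_smul, exteriorDeriv_smul, mul_neg]

theorem mfderiv_tauBar {e : OpenPartialHomeomorph E (ℝ × Fib n)} (he : IsAdapted π e)
    {a : RestrictedCotangent n π m} (ha : a.1.base ∈ e.source)
    (u : TangentSpace (restrictedModel n m) a) :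
    mfderiv (restrictedModel n m) 𝓘(ℝ, ℝ) tauBar a u = (RestrictedCotangent.dcoord e a u).1.1 := by
  have h := (((ContinuousLinearMap.fst ℝ ℝ (JetFib n m)).comp
    (ContinuousLinearMap.fst ℝ (JetModel n m) (JetFib n m))).hasFDerivAt
      (x := a.coord e)).hasMFDerivAt.comp a (RestrictedCotangent.hasMFDerivAt_coord he ha)
  exact DFunLike.congr_fun h.mfderiv u

theorem contDiffAt_partialDeriv_localHamiltonian
    (hLs : ContMDiff 𝓘(ℝ, JetModel n (m + 1)) 𝓘(ℝ, ℝ) ∞ L) (hL : IsHyperregular L)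
    {e : OpenPartialHomeomorph E (ℝ × Fib n)} (he : IsAdapted π e)
    {a : RestrictedCotangent n π m} (ha : a.1.base ∈ e.source) (w : JetModel n m × JetFib n m) :
    ContDiffAt ℝ ∞ (fun z => fderiv ℝ (localHamiltonian hL e ∘
      (RestrictedCotangent.chart a he).symm) z w) (a.coord e) := by
  have hκa : (RestrictedCotangent.chart a he).symm (a.coord e) = a :=
    (RestrictedCotangent.chart a he).left_inv ha
  have h1 : ContMDiffAt 𝓘(ℝ, JetModel n m × JetFib n m) 𝓘(ℝ, ℝ) ∞
      (localHamiltonian hL e ∘ (RestrictedCotangent.chart a he).symm) (a.coord e) := by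
    refine ContMDiffAt.comp _ ?_ (RestrictedCotangent.contMDiffAt_chart_symm a he
      (RestrictedCotangent.coord_mem_target he ha))
    rw [hκa]
    exact contMDiffAt_localHamiltonian hLs hL he ha
  exact ((contMDiffAt_iff_contDiffAt.1 h1).fderiv_right (m := ∞) (by simp)).clm_apply
    contDiffAt_const

theorem isAdapted_adaptedChartAt (x : E) : IsAdapted π (adaptedChartAt n π x) :=
  (IsFibered.exists_adapted (n := n) (π := π) x).choose_spec.1

theorem mem_adaptedChartAt_source (x : E) : x ∈ (adaptedChartAt n π x).source :=
  (IsFibered.exists_adapted (n := n) (π := π) x).choose_spec.2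

/-- The Hamiltonian vector field: the vector field with `dt = 1` in the kernel of `Ω_h`. -/
def hamiltonVectorField (hL : IsHyperregular L) (a : RestrictedCotangent n π m) :
    TangentSpace (restrictedModel n m) a :=
  (RestrictedCotangent.dcoord (adaptedChartAt n π a.1.base) a).inverse
    (hamiltonVec hL (isAdapted_adaptedChartAt a.1.base) a)

theorem dcoord_hamiltonVectorField_self (hL : IsHyperregular L) (a : RestrictedCotangent n π m) :
    RestrictedCotangent.dcoord (adaptedChartAt n π a.1.base) a (hamiltonVectorField hL a) =
      hamiltonVec hL (isAdapted_adaptedChartAt a.1.base) a :=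
  (RestrictedCotangent.dcoord_isInvertible (isAdapted_adaptedChartAt a.1.base)
    (mem_adaptedChartAt_source a.1.base)).self_apply_inverse _

theorem mfderiv_tauBar_hamiltonVectorField (hL : IsHyperregular L)
    (a : RestrictedCotangent n π m) :
    mfderiv (restrictedModel n m) 𝓘(ℝ, ℝ) tauBar a (hamiltonVectorField hL a) = (1 : ℝ) := by
  rw [mfderiv_tauBar (isAdapted_adaptedChartAt a.1.base) (mem_adaptedChartAt_source a.1.base),
    dcoord_hamiltonVectorField_self]
  rfl

variable (hLs : ContMDiff 𝓘(ℝ, JetModel n (m + 1)) 𝓘(ℝ, ℝ) ∞ L)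
include hLs

theorem hamiltonCartanTwoForm_hamiltonVectorField (hL : IsHyperregular L)
    (a : RestrictedCotangent n π m) (v : TangentSpace (restrictedModel n m) a) :
    hamiltonCartanTwoForm hL a (hamiltonVectorField hL a) v = 0 := by
  refine (hamiltonCartanTwoForm_eq_zero_iff hLs hL (isAdapted_adaptedChartAt a.1.base)
    (mem_adaptedChartAt_source a.1.base) ?_).2 (dcoord_hamiltonVectorField_self hL a) v
  rw [dcoord_hamiltonVectorField_self]
  rfl

/-- H depends on the adapted chart, but lying in the kernel of Ω_h with dt = 1 does not. Uniqueness
of that kernel vector therefore gives the Hamiltonian components in every adapted chart, without a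
transformation law for H. -/
theorem dcoord_hamiltonVectorField (hL : IsHyperregular L)
    {e : OpenPartialHomeomorph E (ℝ × Fib n)} (he : IsAdapted π e)
    {a : RestrictedCotangent n π m} (ha : a.1.base ∈ e.source) :
    RestrictedCotangent.dcoord e a (hamiltonVectorField hL a) = hamiltonVec hL he a := by
  refine (hamiltonCartanTwoForm_eq_zero_iff hLs hL he ha ?_).1
    (hamiltonCartanTwoForm_hamiltonVectorField hLs hL a)
  rw [← mfderiv_tauBar he ha, mfderiv_tauBar_hamiltonVectorField]

/-- The chart chosen in the definition may jump with the point. Chart independence allows the chart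
at `a₀` to be used on a whole neighbourhood, where the components are partial derivatives of a
smooth H. -/
theorem isSmoothVectorField_hamiltonVectorField (hL : IsHyperregular L) :
    IsSmoothVectorField (restrictedModel n m)
      (hamiltonVectorField (n := n) (π := π) (L := L) hL) := by
  intro a₀
  have he := isAdapted_adaptedChartAt (n := n) (π := π) a₀.1.base
  have ha₀ := mem_adaptedChartAt_source (n := n) (π := π) a₀.1.base
  have hd := contDiffAt_partialDeriv_localHamiltonian hLs hL he ha₀
  have hF : ContDiffAt ℝ ∞ (fun z : JetModel n m × JetFib n m =>
      (((1, fun i A => fderiv ℝ (localHamiltonian hL (adaptedChartAt n π a₀.1.base) ∘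
        (RestrictedCotangent.chart a₀ he).symm) z (0, qVec i A)),
        fun i A => -fderiv ℝ (localHamiltonian hL (adaptedChartAt n π a₀.1.base) ∘
        (RestrictedCotangent.chart a₀ he).symm) z ((0, qVec i A), 0)) :
          JetModel n m × JetFib n m)) (a₀.coord (adaptedChartAt n π a₀.1.base)) :=
    (contDiffAt_const.prodMk (contDiffAt_pi.2 fun i => contDiffAt_pi.2 fun A =>
      hd (0, qVec i A))).prodMk
        (contDiffAt_pi.2 fun i => contDiffAt_pi.2 fun A => (hd ((0, qVec i A), 0)).neg)
  refine RestrictedCotangent.contMDiffAt_vectorField he ha₀ hF ?_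
  filter_upwards [RestrictedCotangent.eventually_base_mem he ha₀] with a ha
  rw [dcoord_hamiltonVectorField hLs hL he ha, hamiltonVec]
  simp only [RestrictedCotangent.partialDeriv_eq a₀ he ha]

end HamiltonVectorField

/-! ### Velocities of sections in natural coordinates. -/

section Curves
variable {m : ℕ} {ψ : ℝ → RestrictedCotangent n π m}

theorem mfderiv_curve_apply (t s : ℝ) :
    mfderiv 𝓘(ℝ, ℝ) (restrictedModel n m) ψ t s =
      s • mfderiv 𝓘(ℝ, ℝ) (restrictedModel n m) ψ t (1 : ℝ) := by
  let l : ℝ →L[ℝ] JetModel n m × JetFib n m := mfderiv 𝓘(ℝ, ℝ) (restrictedModel n m) ψ t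
  change l s = s • l 1
  rw [← map_smul, smul_eq_mul, mul_one]

theorem hasDerivAt_coord_curve (hψ : ContMDiff 𝓘(ℝ, ℝ) (restrictedModel n m) ∞ ψ)
    {e : OpenPartialHomeomorph E (ℝ × Fib n)} (he : IsAdapted π e) {t : ℝ}
    (ht : (ψ t).1.base ∈ e.source) :
    HasDerivAt (fun s => (ψ s).coord e) (RestrictedCotangent.dcoord e (ψ t)
      (mfderiv 𝓘(ℝ, ℝ) (restrictedModel n m) ψ t (1 : ℝ))) t := by
  let D : ℝ →L[ℝ] JetModel n m × JetFib n m := (RestrictedCotangent.dcoord e (ψ t)).comp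
    (mfderiv 𝓘(ℝ, ℝ) (restrictedModel n m) ψ t)
  have h : HasFDerivAt (fun s => (ψ s).coord e) D t :=
    ((RestrictedCotangent.hasMFDerivAt_coord he ht).comp t
      ((hψ t).mdifferentiableAt (by simp)).hasMFDerivAt).hasFDerivAt
  exact h.hasDerivAt

/-- The components of the velocity of a section of the phase space. -/
theorem dcoord_velocity_curve (hψ : ContMDiff 𝓘(ℝ, ℝ) (restrictedModel n m) ∞ ψ)
    (hsec : ∀ t, tauBar (ψ t) = t)
    {e : OpenPartialHomeomorph E (ℝ × Fib n)} (he : IsAdapted π e) {t : ℝ}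
    (ht : (ψ t).1.base ∈ e.source) :
    RestrictedCotangent.dcoord e (ψ t) (mfderiv 𝓘(ℝ, ℝ) (restrictedModel n m) ψ t (1 : ℝ)) =
      ((1, fun i A => deriv (fun s => ((ψ s).1.coord e).2 i A) t),
        fun i A => deriv (fun s => (ψ s).momentum e i A) t) := by
  have h := hasDerivAt_coord_curve hψ he ht
  have h1 : HasDerivAt (fun s => ((ψ s).coord e).1) _ t :=
    (hasFDerivAt_fst (𝕜 := ℝ)).comp_hasDerivAt t h
  have h2 : HasDerivAt (fun s => ((ψ s).coord e).2) _ t :=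
    (hasFDerivAt_snd (𝕜 := ℝ)).comp_hasDerivAt t h
  have h11 : HasDerivAt (fun s => ((ψ s).coord e).1.1) _ t :=
    (hasFDerivAt_fst (𝕜 := ℝ)).comp_hasDerivAt t h1
  have h12 : HasDerivAt (fun s => ((ψ s).coord e).1.2) _ t :=
    (hasFDerivAt_snd (𝕜 := ℝ)).comp_hasDerivAt t h1
  refine Prod.ext (Prod.ext ?_ ?_) ?_
  -- The curve is a section, so its time coordinate is the identity, with derivative 1.
  · have h0 : (fun s => ((ψ s).coord e).1.1) = fun s => s := funext hsec
    rw [h0] at h11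
    exact h11.unique (hasDerivAt_id t)
  · funext i A
    exact (hasDerivAt_pi.1 (hasDerivAt_pi.1 h12 i) A).deriv.symm
  · funext i A
    exact (hasDerivAt_pi.1 (hasDerivAt_pi.1 h2 i) A).deriv.symm

end Curves

end HigherOrderMechanics

end

/-! ### The four equivalent conditions, with condition 3 as the hub. -/

theorem mainTheorem5 {n m : ℕ} {E : Type*} [TopologicalSpace E] [T2Space E]
    [SecondCountableTopology E] [ChartedSpace (ℝ × Fib n) E] [IsManifold 𝓘(ℝ, ℝ × Fib n) ∞ E]
    (π : E → ℝ) [IsFibered n π]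
    (L : Jet n π (m + 1) → ℝ) (hLsmooth : ContMDiff 𝓘(ℝ, JetModel n (m + 1)) 𝓘(ℝ, ℝ) ∞ L)
    (hL : IsHyperregular L)
    (ψ : ℝ → RestrictedCotangent n π m) (hψ : ContMDiff 𝓘(ℝ, ℝ) (restrictedModel n m) ∞ ψ)
    (hsec : ∀ t, tauBar (ψ t) = t) :
    List.TFAE [
      ∀ Y : (a : RestrictedCotangent n π m) → TangentSpace (restrictedModel n m) a,
        IsSmoothVectorField (restrictedModel n m) Y →
        ∀ (t : ℝ) (s : TangentSpace 𝓘(ℝ, ℝ) t), hamiltonCartanTwoForm hL (ψ t) (Y (ψ t))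
          (mfderiv 𝓘(ℝ, ℝ) (restrictedModel n m) ψ t s) = 0,
      ∀ (e : OpenPartialHomeomorph E (ℝ × Fib n)) (he : IsAdapted π e) (t : ℝ),
        (ψ t).1.base ∈ e.source → ∀ (i : Fin (m + 1)) (A : Fin n),
        deriv (fun s => ((ψ s).1.coord e).2 i A) t =
            RestrictedCotangent.partialDeriv he (0, qVec i A) (localHamiltonian hL e) (ψ t) ∧
        deriv (fun s => (ψ s).momentum e i A) t =
          -RestrictedCotangent.partialDeriv he ((0, qVec i A), 0) (localHamiltonian hL e) (ψ t),
      ∀ (t : ℝ) (v : TangentSpace (restrictedModel n m) (ψ t)),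
        hamiltonCartanTwoForm hL (ψ t) (mfderiv 𝓘(ℝ, ℝ) (restrictedModel n m) ψ t (1 : ℝ)) v = 0,
      ∃ X : (a : RestrictedCotangent n π m) → TangentSpace (restrictedModel n m) a,
        IsSmoothVectorField (restrictedModel n m) X ∧
        (∀ a, mfderiv (restrictedModel n m) 𝓘(ℝ, ℝ) tauBar a (X a) ≠ (0 : ℝ)) ∧
        (∀ a (v : TangentSpace (restrictedModel n m) a), hamiltonCartanTwoForm hL a (X a) v = 0) ∧
        IsMIntegralCurve ψ X] := by
  tfae_have 1 → 3 := by
    intro h t v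
    -- Condition 1 tests with global fields only, so the given vector is first extended to one.
    obtain ⟨Y, hY, rfl⟩ := RestrictedCotangent.exists_vectorField (ψ t) v
    rw [hamiltonCartanTwoForm_swap]
    exact neg_eq_zero.2 (h Y hY t (1 : ℝ))
  tfae_have 3 → 1 := by
    intro h Y _ t s
    rw [mfderiv_curve_apply t s]
    refine (hamiltonCartanTwoForm_smul hL _ s _ _).trans ?_
    rw [hamiltonCartanTwoForm_swap, h, neg_zero]
    exact mul_zero (M₀ := ℝ) s
  -- This normalization is what the kernel criterion requires of a vector.
  have hdt : ∀ (e : OpenPartialHomeomorph E (ℝ × Fib n)), IsAdapted π e → ∀ t,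
      (ψ t).1.base ∈ e.source → (RestrictedCotangent.dcoord e (ψ t)
        (mfderiv 𝓘(ℝ, ℝ) (restrictedModel n m) ψ t (1 : ℝ))).1.1 = 1 := by
    intro e he t ht
    rw [dcoord_velocity_curve hψ hsec he ht]
  tfae_have 3 → 2 := by
    intro h e he t ht i A
    have h1 := (hamiltonCartanTwoForm_eq_zero_iff hLsmooth hL he ht (hdt e he t ht)).1 (h t)
    rw [dcoord_velocity_curve hψ hsec he ht] at h1
    exact ⟨congrFun (congrFun (congrArg (fun w => w.1.2) h1) i) A,
      congrFun (congrFun (congrArg (fun w => w.2) h1) i) A⟩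
  tfae_have 2 → 3 := by
    intro h t
    have he := isAdapted_adaptedChartAt (n := n) (π := π) (ψ t).1.base
    have ht := mem_adaptedChartAt_source (n := n) (π := π) (ψ t).1.base
    refine (hamiltonCartanTwoForm_eq_zero_iff hLsmooth hL he ht (hdt _ he t ht)).2 ?_
    rw [dcoord_velocity_curve hψ hsec he ht]
    exact Prod.ext (Prod.ext rfl (funext fun i => funext fun A => (h _ he t ht i A).1))
      (funext fun i => funext fun A => (h _ he t ht i A).2)
  tfae_have 4 → 3 := by
    rintro ⟨X, _, _, hX, hint⟩ t v
    have h1 : mfderiv 𝓘(ℝ, ℝ) (restrictedModel n m) ψ t (1 : ℝ) = X (ψ t) := by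
      rw [(hint t).mfderiv]
      exact one_smul ℝ (X (ψ t))
    rw [h1]
    exact hX (ψ t) v
  tfae_have 3 → 4 := by
    intro h
    -- The witness does not depend on ψ: one field serves all solutions.
    refine ⟨hamiltonVectorField hL, isSmoothVectorField_hamiltonVectorField hLsmooth hL,
      fun a => ?_, hamiltonCartanTwoForm_hamiltonVectorField hLsmooth hL, fun t => ?_⟩
    · rw [mfderiv_tauBar_hamiltonVectorField]
      exact one_ne_zero (α := ℝ)
    · have he := isAdapted_adaptedChartAt (n := n) (π := π) (ψ t).1.base
      have ht := mem_adaptedChartAt_source (n := n) (π := π) (ψ t).1.base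
      have h1 := (hamiltonCartanTwoForm_eq_zero_iff hLsmooth hL he ht (hdt _ he t ht)).1 (h t)
      rw [← dcoord_hamiltonVectorField hLsmooth hL he ht] at h1
      -- Both ψ' and the field have the Hamiltonian components in this chart, hence they are equal
      -- as tangent vectors.
      have h2 := (RestrictedCotangent.dcoord_isInvertible he ht).injective h1
      refine ((hψ t).mdifferentiableAt (by simp)).hasMFDerivAt.congr_mfderiv ?_
      rw [← h2]
      exact ContinuousLinearMap.ext fun s => mfderiv_curve_apply t s
  tfae_finish
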